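/- **Setting.** There are $n$ applicants and $n$ institutions. A type of an applicant is a strict ranking of some subset of the institutions (her preference list of acceptable institutions); the set $\mathcal T_a$ of possible types of applicant $a$ may be any set of such lists (for instance all lists, or all complete lists). Each institution $h$ has a strict priority order $\succ_h$ over all applicants. An outcome is a partial one-to-one matching. *Top Trading Cycles* (TTC) repeats the following until every applicant is matched or has exhausted her list: each remaining applicant (unmatched, list not exhausted) points to her favorite remaining institution, each remaining institution points to its highest-priority remaining applicant, and some cycle of this graph is executed (each applicant on it is permanently matched to the institution she points to). The *menu* of applicant $i$ at a type profile $t$ is the set of all matches (institutions, or "unmatched") that $i$ can receive when the types $t_{-i}$ of the others are fixed and her own type ranges over $\mathcal T_i$. An *extensive-form outcome description* of a social choice function $f$ is a finite directed graph with a single source, whose vertices are organized in layers $1,\dots,L$, with edges only from a layer to the next one. Each vertex $v$ of out-degree at least $2$ queries one applicant $a$ and has a transition function from $\mathcal T_a$ to the edges leaving $v$; other vertices query nobody. A type profile $t$ determines an evaluation path from the source to a sink, and the sinks are labeled by outcomes so that the sink reached on $t$ is labeled $f(t)$. It is an *individualized dictatorship description* for applicant $i$ if for some layer $k$, every vertex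 in a layer before $k$ queries some applicant other than $i$, and every vertex $v$ in layer $k$ queries $i$ and is labeled by a set that equals the menu of $i$ at every profile whose evaluation path visits $v$. It is *applicant-proposing* if on every evaluation path, for every applicant $a$ and every $j$, the transition function at the $j$-th vertex that queries $a$ depends only on the $j$-th institution on $a$'s list ("empty" if the list is shorter). Its *memory* is $\log_2$ of the maximum number of vertices in a layer. **Theorem.** There is a function $B(n)=\widetilde{O}(n)$ (that is, $B(n)=O(n\log^k n)$ for some constant $k$) such that for every $n$, all type sets, all priorities and every applicant $i$, TTC has an applicant-proposing individualized dictatorship description for $i$ with memory at most $B(n)$; that is, TTC has an applicant-linear individualized dictatorship description for each applicant. Moreover, fix a type profile and start TTC by executing, for as long as possible, only cycles that do not involve $i$, where $i$ stays in the market during this stage (institutions may point to her) whatever her list is. Let $R$ be the set of institutions that remain, and $\mu$ the partial matching reached. Then $i$'s menu consists of the favorites in $R$ ("unmatched" if no institution of $R$ is acceptable) of all types in $\mathcal T_i$. In particular it is $R$ together with "unmatched" if $\mathcal T_i$ contains all lists, and it is $R$ if $\mathcal T_i$ is the set of complete lists. Continuing TTC from $\mu$, executing cycles in any order, yields the TTC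 matching. -/

import Mathlib

/-! ### Matching environments -/

/-- A type of an applicant: a strict ranking (from favorite to least favorite) of some subset of
the institutions, the acceptable ones. -/
def PrefList (H : Type) : Type := {l : List H // l.Nodup}

/-- A partial one-to-one matching of applicants to institutions. -/
@[ext] structure Matching (A H : Type) where
  /-- The institution that an applicant is matched to, `none` if she is unmatched. -/
  inst : A → Option H
  one_to_one : ∀ a b h, inst a = some h → inst b = some h → a = b

/-- The matching in which everyone is unmatched. -/
def Matching.empty (A H : Type) : Matching A H where
  inst := fun _ => none
  one_to_one := by intro a b h hh; simp at hh

/-! ### Top Trading Cycles -/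

section TTC

variable {A H : Type} [Fintype A] [DecidableEq A] [Fintype H] [DecidableEq H]

/-- The remaining (not yet matched) institutions. -/
def Matching.freeInst (μ : Matching A H) : Finset H :=
  Finset.univ.filter fun h => ∀ a, μ.inst a ≠ some h

/-- The highest ranked institution of `R` on the list `l`, `none` if no institution of `R` is
on the list. -/
def favorite (l : PrefList H) (R : Finset H) : Option H :=
  l.1.find? fun h => decide (h ∈ R)

/-- The remaining applicants: those who are not yet matched and have not exhausted their
preference lists. -/
def activeApplicants (t : A → PrefList H) (μ : Matching A H) : Finset A :=
  Finset.univ.filter fun a => μ.inst a = none ∧ favorite (t a) μ.freeInst ≠ none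

/-- Among the applicants in `S`, applicant `a` has the highest priority at `h` (larger in the
linear order `P h` means higher priority). -/
def IsTopPriority (P : H → LinearOrder A) (S : Finset A) (h : H) (a : A) : Prop :=
  a ∈ S ∧ ∀ b ∈ S, (P h).le b a

/-- A trading cycle `c 0 → p 0 → c 1 → p 1 → ⋯ → c k → p k → c 0` (indices are taken modulo
`k + 1`) in the pointing graph on the applicants in `S` and the institutions in `R`: each
applicant points to her favorite institution in `R`, and each institution points to its highest
priority applicant in `S`. -/
structure IsTradingCycle (P : H → LinearOrder A) (t : A → PrefList H) (R : Finset H)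
    (S : Finset A) {k : ℕ} (c : Fin (k + 1) → A) (p : Fin (k + 1) → H) : Prop where
  injective : Function.Injective c
  mem : ∀ j, c j ∈ S
  applicant_points : ∀ j, favorite (t (c j)) R = some (p j)
  institution_points : ∀ j, IsTopPriority P S (p j) (c (j + 1))

/-- `ν` arises from `μ` by matching each applicant `c j` to `p j`. -/
def Executes (μ ν : Matching A H) {k : ℕ} (c : Fin (k + 1) → A) (p : Fin (k + 1) → H) : Prop :=
  (∀ j, ν.inst (c j) = some (p j)) ∧ ∀ a, a ∉ Set.range c → ν.inst a = μ.inst a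

/-- One iteration of Top Trading Cycles: some cycle among the remaining applicants and
institutions is executed. -/
def TTCStep (P : H → LinearOrder A) (t : A → PrefList H) (μ ν : Matching A H) : Prop :=
  ∃ (k : ℕ) (c : Fin (k + 1) → A) (p : Fin (k + 1) → H),
    IsTradingCycle P t μ.freeInst (activeApplicants t μ) c p ∧ Executes μ ν c p

/-- `ν` can be the final matching of Top Trading Cycles when it is started from the partial
matching `μ`: iterate until everyone is matched or has exhausted her preference list. -/
def TTCRun (P : H → LinearOrder A) (t : A → PrefList H) (μ ν : Matching A H) : Prop :=
  Relation.ReflTransGen (TTCStep P t) μ ν ∧ activeApplicants t ν = ∅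

theorem exists_ttcStep (P : H → LinearOrder A) (t : A → PrefList H) (μ : Matching A H)
    (hne : (activeApplicants t μ).Nonempty) : ∃ ν, TTCStep P t μ ν := by
  classical
  set S := activeApplicants t μ with hS
  set R := μ.freeInst with hR
  have hfav : ∀ a : S, ∃ h, favorite (t a) R = some h := by
    intro a
    have hmem : (a : A) ∈ activeApplicants t μ := a.2
    rw [activeApplicants, Finset.mem_filter] at hmem
    exact Option.ne_none_iff_exists'.mp hmem.2.2
  choose q hq using hfav
  have htop : ∀ h, ∃ a : S, IsTopPriority P S h a := by
    intro h
    let _ := P h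
    obtain ⟨a, ha, hmax⟩ := S.exists_max_image id hne
    exact ⟨⟨a, ha⟩, ha, hmax⟩
  choose top htop using htop
  let F : S → S := fun a => top (q a)
  obtain ⟨x, hx⟩ := hne
  obtain ⟨m, n, hmn, hF⟩ :=
    Finite.exists_ne_map_eq_of_infinite (fun m : ℕ => F^[m] ⟨x, hx⟩)
  have key : ∃ y : S, y ∈ Function.periodicPts F := by
    wlog hlt : m < n generalizing m n
    · exact this n m hmn.symm hF.symm (lt_of_le_of_ne (not_lt.mp hlt) hmn.symm)
    refine ⟨F^[m] ⟨x, hx⟩, n - m, by omega, ?_⟩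
    have h2 : F^[n - m] (F^[m] ⟨x, hx⟩) = F^[n] ⟨x, hx⟩ := by
      rw [← Function.iterate_add_apply, Nat.sub_add_cancel hlt.le]
    exact h2.trans hF.symm
  obtain ⟨y, hy⟩ := key
  obtain ⟨k, hk⟩ : ∃ k, Function.minimalPeriod F y = k + 1 :=
    ⟨_, (Nat.succ_pred_eq_of_pos (Function.minimalPeriod_pos_of_mem_periodicPts hy)).symm⟩
  let c : Fin (k + 1) → S := fun j => F^[j] y
  have hcinj : Function.Injective c := by
    intro i j hij
    apply Fin.ext
    exact Function.iterate_injOn_Iio_minimalPeriod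
      (by rw [Set.mem_Iio, hk]; exact i.2) (by rw [Set.mem_Iio, hk]; exact j.2) hij
  have hcsucc : ∀ j, c (j + 1) = F (c j) := by
    intro j
    have h1 : ((j + 1 : Fin (k + 1)) : ℕ) = (j + 1) % (k + 1) := by
      simp [Fin.val_add]
    change F^[((j + 1 : Fin (k + 1)) : ℕ)] y = F (F^[j] y)
    have h2 := Function.iterate_mod_minimalPeriod_eq (f := F) (x := y) (n := (j : ℕ) + 1)
    rw [hk] at h2
    rw [h1, h2, Function.iterate_succ_apply']
  have hcyc : IsTradingCycle P t R S (fun j => (c j : A)) (fun j => q (c j)) :=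
    { injective := Subtype.val_injective.comp hcinj
      mem := fun j => (c j).2
      applicant_points := fun j => hq (c j)
      institution_points := fun j => by
        have := htop (q (c j))
        rw [hcsucc]
        exact this }
  have hinR : ∀ (a : A) (h : H), favorite (t a) R = some h → h ∈ R := by
    intro a h hh
    simpa using List.find?_some hh
  have hfree : ∀ h ∈ R, ∀ a, μ.inst a ≠ some h := by
    intro h hh
    rw [hR, Matching.freeInst, Finset.mem_filter] at hh
    exact hh.2
  let ν : Matching A H :=
    { inst := fun a => if a ∈ Set.range (fun j => (c j : A)) then favorite (t a) R
        else μ.inst a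
      one_to_one := by
        intro a b h ha hb
        by_cases h1 : a ∈ Set.range (fun j => (c j : A)) <;>
          by_cases h2 : b ∈ Set.range (fun j => (c j : A))
        · rw [if_pos h1] at ha
          rw [if_pos h2] at hb
          obtain ⟨i, rfl⟩ := h1
          obtain ⟨j, rfl⟩ := h2
          have e1 : q (c i) = h := Option.some.inj ((hq (c i)).symm.trans ha)
          have e2 : q (c j) = h := Option.some.inj ((hq (c j)).symm.trans hb)
          have e3 : c (i + 1) = c (j + 1) := by
            rw [hcsucc, hcsucc]; simp only [F, e1, e2]
          have e4 := add_right_cancel (hcinj e3)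
          rw [e4]
        · rw [if_pos h1] at ha
          rw [if_neg h2] at hb
          exact absurd hb (hfree h (hinR a h ha) b)
        · rw [if_neg h1] at ha
          rw [if_pos h2] at hb
          exact absurd ha (hfree h (hinR b h hb) a)
        · rw [if_neg h1] at ha
          rw [if_neg h2] at hb
          exact μ.one_to_one a b h ha hb }
  refine ⟨ν, k, _, _, hcyc, ?_, ?_⟩
  · intro j
    change (if (c j : A) ∈ Set.range (fun j => (c j : A)) then favorite (t (c j)) R
      else μ.inst (c j)) = some (q (c j))
    rw [if_pos ⟨j, rfl⟩]
    exact hq (c j)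
  · intro a ha
    exact if_neg ha

theorem exists_ttcRun (P : H → LinearOrder A) (t : A → PrefList H) (μ : Matching A H) :
    ∃ ν, TTCRun P t μ ν := by
  induction hN : (Finset.univ.filter fun a => μ.inst a = none).card using Nat.strong_induction_on
    generalizing μ with
  | _ N ih =>
    rcases (activeApplicants t μ).eq_empty_or_nonempty with h | h
    · exact ⟨μ, Relation.ReflTransGen.refl, h⟩
    · obtain ⟨ν, hν⟩ := exists_ttcStep P t μ h
      have hlt : (Finset.univ.filter fun a => ν.inst a = none).card < N := by
        rw [← hN]
        obtain ⟨k, c, p, hc, he1, he2⟩ := hν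
        apply Finset.card_lt_card
        rw [Finset.ssubset_iff_of_subset]
        · refine ⟨c 0, ?_, ?_⟩
          · have := hc.mem 0
            rw [activeApplicants, Finset.mem_filter] at this
            simp [this.2.1]
          · simp [he1 0]
        · intro a ha
          rw [Finset.mem_filter] at ha ⊢
          refine ⟨ha.1, ?_⟩
          by_cases hr : a ∈ Set.range c
          · obtain ⟨j, rfl⟩ := hr
            rw [he1 j] at ha
            simp at ha
          · rw [← he2 a hr]
            exact ha.2
      obtain ⟨ξ, hξ, hξ'⟩ := ih _ hlt ν rfl
      exact ⟨ξ, Relation.ReflTransGen.head hν hξ, hξ'⟩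

/-- The social choice function of Top Trading Cycles: the final matching of a run of the
procedure, where the cycles may be executed in an arbitrary order. -/
noncomputable def ttc (P : H → LinearOrder A) (t : A → PrefList H) : Matching A H :=
  (exists_ttcRun P t (Matching.empty A H)).choose

/-- Top Trading Cycles in the matching environment in which `𝒯 a` is the set of types of
applicant `a`. -/
noncomputable def ttcOn (P : H → LinearOrder A) (𝒯 : A → Set (PrefList H))
    (t : (a : A) → 𝒯 a) : Matching A H :=
  ttc P fun a => (t a).1

/-- One iteration of Top Trading Cycles while applicant `i` stays in the market without pointing
to any institution: some cycle that does not involve `i` is executed. -/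
def TTCStepWithout (P : H → LinearOrder A) (i : A) (t : A → PrefList H)
    (μ ν : Matching A H) : Prop :=
  ∃ (k : ℕ) (c : Fin (k + 1) → A) (p : Fin (k + 1) → H),
    IsTradingCycle P t μ.freeInst (insert i (activeApplicants t μ)) c p ∧ (∀ j, c j ≠ i) ∧
      Executes μ ν c p

/-- `μ` arises from the empty matching by executing cycles that do not involve `i` for as long as
there are any. -/
def TTCRunWithout (P : H → LinearOrder A) (i : A) (t : A → PrefList H)
    (μ : Matching A H) : Prop :=
  Relation.ReflTransGen (TTCStepWithout P i t) (Matching.empty A H) μ ∧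
    ∀ ν, ¬ TTCStepWithout P i t μ ν

end TTC

/-! ### Extensive-form descriptions -/

/-- An extensive-form description for the players in `ι`, where `T i` is the set of types of
player `i`. An edge is identified with the vertex it leads to. -/
structure ExtensiveFormDescription (ι : Type) (T : ι → Type) where
  /-- The vertices. -/
  V : Type
  [fintypeV : Fintype V]
  /-- The number of layers. -/
  L : ℕ
  /-- The layer of a vertex. -/
  layer : V → ℕ
  layer_mem : ∀ v, layer v ∈ Finset.Icc 1 L
  /-- The out-neighbors of a vertex. -/
  succ : V → Finset V
  layer_succ : ∀ v, ∀ w ∈ succ v, layer w = layer v + 1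
  /-- The source. -/
  source : V
  layer_source : layer source = 1
  source_unique : ∀ v, v ≠ source → ∃ u, v ∈ succ u
  /-- The player queried at a vertex, if there is one. -/
  query : V → Option ι
  query_isSome_iff : ∀ v, (query v).isSome ↔ 2 ≤ (succ v).card
  /-- If `v` queries player `i`, then `next v i` is the transition function of `v`. -/
  next : V → (i : ι) → T i → V
  next_mem : ∀ v i, query v = some i → ∀ x, next v i x ∈ succ v

attribute [instance] ExtensiveFormDescription.fintypeV

namespace ExtensiveFormDescription

variable {ι : Type} {T : ι → Type} (D : ExtensiveFormDescription ι T)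

/-- On the type profile `t`, the evaluation path moves from `v` to `w`. -/
def Step (t : (i : ι) → T i) (v w : D.V) : Prop :=
  w ∈ D.succ v ∧ ∀ i, D.query v = some i → w = D.next v i (t i)

/-- `D.Visits t v m`: the evaluation path on `t` visits `v`, and for each player `i`, exactly
`m i` vertices strictly before `v` on this path query player `i`. -/
inductive Visits [DecidableEq ι] (t : (i : ι) → T i) : D.V → (ι → ℕ) → Prop
  | source : Visits t D.source (fun _ => 0)
  | step {v w : D.V} {m : ι → ℕ} : Visits t v m → D.Step t v w →
      Visits t w (fun i => m i + if D.query v = some i then 1 else 0)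

/-- The vertex `v` is on the evaluation path on `t`. -/
def OnPath (t : (i : ι) → T i) (v : D.V) : Prop :=
  Relation.ReflTransGen (D.Step t) D.source v

/-- The sinks can be labeled by outcomes such that on each type profile `t`, the sink that is
reached is labeled by `f t`. -/
def IsOutcomeDescription {Ω : Type} (f : ((i : ι) → T i) → Ω) : Prop :=
  ∃ label : D.V → Ω, ∀ t v, D.OnPath t v → D.succ v = ∅ → label v = f t

/-- The memory requirement: the base 2 logarithm of the maximal number of vertices in a layer. -/
noncomputable def memory : ℝ :=
  Real.logb 2 (((Finset.Icc 1 D.L).sup fun j =>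
    (Finset.univ.filter fun v => D.layer v = j).card : ℕ) : ℝ)

end ExtensiveFormDescription

/-- The menu of applicant `i` with respect to the types `t j`, `j ≠ i`, in the social choice
function `f`. The `i`-outcome of a matching is identified with the institution that `i` is matched
to (`none` if she is unmatched). -/
def menu {A H : Type} [DecidableEq A] {T : A → Type} (f : ((a : A) → T a) → Matching A H)
    (i : A) (t : (a : A) → T a) : Set (Option H) :=
  {o | ∃ x : T i, (f (Function.update t i x)).inst i = o}

namespace ExtensiveFormDescription

/-- `D` is an individualized dictatorship description of `f` for applicant `i`. -/
def IsIndividualizedDictatorship {A H : Type} [DecidableEq A] {T : A → Type}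
    (D : ExtensiveFormDescription A T) (f : ((a : A) → T a) → Matching A H) (i : A) : Prop :=
  D.IsOutcomeDescription f ∧
    ∃ k ∈ Finset.Icc 1 D.L,
      (∀ v, D.layer v < k → ∃ a, a ≠ i ∧ D.query v = some a) ∧
      (∀ v, D.layer v = k → D.query v = some i) ∧
      ∃ M : D.V → Set (Option H),
        ∀ v, D.layer v = k → ∀ t, D.OnPath t v → M v = menu f i t

/-- `D` is applicant-proposing: at the `j`-th vertex of an evaluation path that queries applicant
`i`, the transition function depends only on the `j`-th institution on the preference list of `i`
(`none` if the list is shorter). Here `j = m i + 1`, which is position `m i` of the list, counted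
from `0`. -/
def IsApplicantProposing {A H : Type} [DecidableEq A] {𝒯 : A → Set (PrefList H)}
    (D : ExtensiveFormDescription A fun a => 𝒯 a) : Prop :=
  ∀ t v m, D.Visits t v m → ∀ i, D.query v = some i →
    ∀ x y : 𝒯 i, x.1.1[m i]? = y.1.1[m i]? → D.next v i x = D.next v i y

end ExtensiveFormDescription

/-- `f = Õ(g)`: big O up to logarithmic factors. -/
def IsSoftO (f g : ℕ → ℝ) : Prop :=
  ∃ k : ℕ, f =O[Filter.atTop] fun n => g n * Real.log (g n) ^ k

/-!
Distinct cycles of the same pointing graph are disjoint, and executing one of them leaves the others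
cycles. So executing cycles is a confluent relation on matchings, and cycles may be executed in any
order. Cycles that do not involve `i` do not depend on the list of `i`; once none of them is left,
every further cycle involves `i` and gives her the institution she points to, her favorite among the
remaining ones. This determines her menu.

For the description, lists are read entry by entry. Of most applicants, only the number of entries
read so far, the current match and the last entry read are remembered, which takes `O(log n)` bits
each. The lists of two applicants are remembered entirely: that of `i`, and that of an auxiliary
applicant `d ≠ i`, which is read at the beginning. The number of entries that a run needs varies
with the profile, while all evaluation paths have to reach the query of the menu of `i` in the same
layer. So the shorter runs are padded by redundant queries, to `d` before that layer and to `i` from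
it on, and these must not lose any information.
-/

section Favorite

variable {H : Type} [DecidableEq H] {l : PrefList H} {R R' : Finset H} {h : H}

theorem mem_of_favorite_eq_some (hl : favorite l R = some h) : h ∈ R := by
  simpa using List.find?_some hl

theorem favorite_eq_none_iff : favorite l R = none ↔ ∀ h ∈ l.1, h ∉ R := by
  simp [favorite, List.find?_eq_none]

theorem favorite_eq_some_of_subset (hl : favorite l R = some h) (hR : R' ⊆ R) (hh : h ∈ R') :
    favorite l R' = some h := by
  rw [favorite, List.find?_eq_some_iff_append] at hl ⊢
  obtain ⟨-, as, bs, hl, has⟩ := hl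
  refine ⟨by simpa using hh, as, bs, hl, fun a ha => ?_⟩
  have haR : a ∉ R := by simpa using has a ha
  simpa using fun h' => haR (hR h')

theorem favorite_eq_none_of_subset (hl : favorite l R = none) (hR : R' ⊆ R) :
    favorite l R' = none :=
  favorite_eq_none_iff.2 fun h hh h' => favorite_eq_none_iff.1 hl h hh (hR h')

theorem setOf_favorite_univ (R : Finset H) :
    {o | ∃ l ∈ (Set.univ : Set (PrefList H)), favorite l R = o} =
      insert none (some '' (R : Set H)) := by
  ext o
  constructor
  · rintro ⟨l, -, rfl⟩
    cases hl : favorite l R with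
    | none => exact Set.mem_insert _ _
    | some h => exact Or.inr ⟨h, mem_of_favorite_eq_some hl, rfl⟩
  · rintro (rfl | ⟨h, hh, rfl⟩)
    · exact ⟨⟨[], List.nodup_nil⟩, trivial, rfl⟩
    · exact ⟨⟨[h], List.nodup_singleton h⟩, trivial, by simpa [favorite] using hh⟩

theorem setOf_favorite_complete [Finite H] (hR : R.Nonempty) :
    {o | ∃ l ∈ {l : PrefList H | ∀ h, h ∈ l.1}, favorite l R = o} = some '' (R : Set H) := by
  have := Fintype.ofFinite H
  ext o
  constructor
  · rintro ⟨l, hl, rfl⟩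
    cases hf : favorite l R with
    | none => exact absurd hR.choose_spec (favorite_eq_none_iff.1 hf _ (hl _))
    | some h => exact ⟨h, mem_of_favorite_eq_some hf, rfl⟩
  · rintro ⟨h, hh, rfl⟩
    refine ⟨⟨h :: (Finset.univ.erase h).toList, by simp [Finset.nodup_toList]⟩, fun b => ?_, ?_⟩
    · simp [eq_or_ne b h]
    · simp [favorite, Finset.mem_coe.1 hh]

end Favorite

namespace Matching

variable {A H : Type} {μ ν : Matching A H} {a : A} {h : H}

/-- The matching `ν` extends `μ`: everyone who is matched in `μ` has the same match in `ν`. Along a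
run of Top Trading Cycles the matchings extend each other. -/
def Extends (μ ν : Matching A H) : Prop :=
  ∀ a h, μ.inst a = some h → ν.inst a = some h

theorem extends_of_reflTransGen {r : Matching A H → Matching A H → Prop}
    (hr : ∀ μ ν, r μ ν → μ.Extends ν) (h : Relation.ReflTransGen r μ ν) : μ.Extends ν := by
  induction h with
  | refl => exact fun _ _ h => h
  | tail _ hs ih => exact fun a h ha => hr _ _ hs a h (ih a h ha)

theorem Extends.inst_eq_none (hμ : μ.Extends ν) (ha : ν.inst a = none) : μ.inst a = none := by
  cases h : μ.inst a with
  | none => rfl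
  | some b => simp [hμ a b h] at ha

variable [Fintype A] [Fintype H] [DecidableEq H]

theorem mem_freeInst : h ∈ μ.freeInst ↔ ∀ a, μ.inst a ≠ some h := by
  simp [freeInst]

theorem Extends.freeInst_subset (hμ : μ.Extends ν) : ν.freeInst ⊆ μ.freeInst := by
  intro h hh
  rw [mem_freeInst] at hh ⊢
  exact fun a ha => hh a (hμ a h ha)

theorem freeInst_nonempty (hAH : Fintype.card A ≤ Fintype.card H) (ha : μ.inst a = none) :
    μ.freeInst.Nonempty := by
  by_contra hne
  have hall : ∀ h, ∃ b, μ.inst b = some h := fun h => by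
    simpa [mem_freeInst] using fun hh : h ∈ μ.freeInst => hne ⟨h, hh⟩
  have hsurj : Function.Surjective μ.inst := fun
    | none => ⟨a, ha⟩
    | some h => hall h
  have := Fintype.card_le_of_surjective _ hsurj
  rw [Fintype.card_option] at this
  omega

end Matching

section ActiveApplicants

variable {A H : Type} [Fintype A] [Fintype H] [DecidableEq H] {t t' : A → PrefList H}
  {μ ν : Matching A H} {a : A}

theorem mem_activeApplicants :
    a ∈ activeApplicants t μ ↔ μ.inst a = none ∧ favorite (t a) μ.freeInst ≠ none := by
  simp [activeApplicants]

theorem Matching.Extends.activeApplicants_subset (hμ : μ.Extends ν) (t : A → PrefList H) :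
    activeApplicants t ν ⊆ activeApplicants t μ := by
  intro a ha
  rw [mem_activeApplicants] at ha ⊢
  exact ⟨hμ.inst_eq_none ha.1, fun h => ha.2 (favorite_eq_none_of_subset h hμ.freeInst_subset)⟩

theorem mem_activeApplicants_congr
    (ht : μ.inst a = none → favorite (t a) μ.freeInst = favorite (t' a) μ.freeInst) :
    a ∈ activeApplicants t μ ↔ a ∈ activeApplicants t' μ := by
  rw [mem_activeApplicants, mem_activeApplicants]
  exact and_congr_right fun h => by rw [ht h]

end ActiveApplicants

section IsTopPriority

variable {A H : Type} {P : H → LinearOrder A} {S S' : Finset A} {h : H} {a b : A}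

theorem IsTopPriority.eq (ha : IsTopPriority P S h a) (hb : IsTopPriority P S h b) : a = b :=
  (P h).le_antisymm a b (hb.2 a ha.1) (ha.2 b hb.1)

theorem IsTopPriority.mono (ha : IsTopPriority P S h a) (hS : S' ⊆ S) (ha' : a ∈ S') :
    IsTopPriority P S' h a :=
  ⟨ha', fun b hb => ha.2 b (hS hb)⟩

end IsTopPriority

section Cycles

variable {A H : Type} [DecidableEq H] {P : H → LinearOrder A} {t t' : A → PrefList H}
  {R : Finset H} {S S' : Finset A} {k k' : ℕ} {c : Fin (k + 1) → A} {p : Fin (k + 1) → H}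
  {c' : Fin (k' + 1) → A} {p' : Fin (k' + 1) → H} {μ ν ν' : Matching A H}

open scoped Fin.NatCast Fin.CommRing in
theorem forall_fin_of_forall_add_one {q : Fin (k + 1) → Prop} (hq : ∀ x, q x → q (x + 1))
    {j : Fin (k + 1)} (hj : q j) (x : Fin (k + 1)) : q x := by
  have hall : ∀ m : ℕ, q (j + (m : Fin (k + 1))) := by
    intro m
    induction m with
    | zero => simpa using hj
    | succ m ih => simpa [add_assoc] using hq _ ih
  have := hall (x - j : Fin (k + 1)).val
  rwa [Fin.cast_val_eq_self, add_sub_cancel] at this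

namespace IsTradingCycle

theorem institutions_injective (hc : IsTradingCycle P t R S c p) : Function.Injective p := by
  intro j j' hj
  have hjj' : c (j + 1) = c (j' + 1) :=
    (hj ▸ hc.institution_points j).eq (hc.institution_points j')
  exact add_right_cancel (hc.injective hjj')

theorem range_subset (hc : IsTradingCycle P t R S c p) (hc' : IsTradingCycle P t R S c' p')
    {j : Fin (k + 1)} (hj : c j ∈ Set.range c') : Set.range c ⊆ Set.range c' := by
  refine Set.range_subset_iff.2 (forall_fin_of_forall_add_one ?_ hj)
  rintro x ⟨y, hy⟩
  have hp : p' y = p x :=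
    Option.some.inj ((hc'.applicant_points y).symm.trans (hy ▸ hc.applicant_points x))
  exact ⟨y + 1, (hp ▸ hc'.institution_points y).eq (hc.institution_points x)⟩

theorem range_eq_or_disjoint (hc : IsTradingCycle P t R S c p)
    (hc' : IsTradingCycle P t R S c' p') :
    Set.range c = Set.range c' ∨ Disjoint (Set.range c) (Set.range c') := by
  refine or_iff_not_imp_right.2 fun hd => ?_
  obtain ⟨_, ⟨j, rfl⟩, j', hj'⟩ := Set.not_disjoint_iff.1 hd
  exact (hc.range_subset hc' ⟨j', hj'⟩).antisymm
    (hc'.range_subset hc (j := j') (hj' ▸ Set.mem_range_self j))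

theorem congr (hc : IsTradingCycle P t R S c p) (ht : ∀ j, favorite (t (c j)) R =
    favorite (t' (c j)) R) (hS : S' ⊆ S) (hmem : ∀ j, c j ∈ S') : IsTradingCycle P t' R S' c p :=
  ⟨hc.injective, hmem, fun j => (ht j).symm.trans (hc.applicant_points j),
    fun j => (hc.institution_points j).mono hS (hmem _)⟩

end IsTradingCycle

namespace Executes

theorem inst_of_mem_range (he : Executes μ ν c p)
    (hp : ∀ j, favorite (t (c j)) R = some (p j)) {a : A} (ha : a ∈ Set.range c) :
    ν.inst a = favorite (t a) R := by
  obtain ⟨j, rfl⟩ := ha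
  rw [he.1, hp]

theorem eq_of_range_eq (he : Executes μ ν c p) (he' : Executes μ ν' c' p')
    (hp : ∀ j, favorite (t (c j)) R = some (p j))
    (hp' : ∀ j, favorite (t (c' j)) R = some (p' j)) (hr : Set.range c = Set.range c') :
    ν = ν' := by
  ext1
  funext a
  by_cases ha : a ∈ Set.range c
  · rw [he.inst_of_mem_range hp ha, he'.inst_of_mem_range hp' (hr ▸ ha)]
  · rw [he.2 a ha, he'.2 a (hr ▸ ha)]

end Executes

end Cycles

namespace Executes

variable {A H : Type} {k k' : ℕ} {c : Fin (k + 1) → A} {p : Fin (k + 1) → H}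
  {c' : Fin (k' + 1) → A} {p' : Fin (k' + 1) → H} {μ ν ν' ξ : Matching A H}

theorem extends_of_inst_eq_none (he : Executes μ ν c p) (hμ : ∀ j, μ.inst (c j) = none) :
    μ.Extends ν := by
  intro a h ha
  rw [he.2 a, ha]
  rintro ⟨j, rfl⟩
  simp [hμ j] at ha

theorem comm_of_disjoint (he : Executes μ ν c p) (he' : Executes μ ν' c' p')
    (hξ : Executes ν ξ c' p') (hd : Disjoint (Set.range c) (Set.range c')) :
    Executes ν' ξ c p := by
  refine ⟨fun j => ?_, fun a ha => ?_⟩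
  · rw [hξ.2 _ (Set.disjoint_left.1 hd (Set.mem_range_self j)), he.1]
  · by_cases ha' : a ∈ Set.range c'
    · obtain ⟨m, rfl⟩ := ha'
      rw [hξ.1, he'.1]
    · rw [hξ.2 _ ha', he.2 _ ha, he'.2 _ ha']

end Executes

section Steps

variable {A H : Type} [Fintype A] [Fintype H] [DecidableEq H] {P : H → LinearOrder A}
  {t t' : A → PrefList H} {μ ν ν₁ ν₂ : Matching A H} {S : Finset A} {k k' : ℕ}
  {c : Fin (k + 1) → A} {p : Fin (k + 1) → H} {c' : Fin (k' + 1) → A} {p' : Fin (k' + 1) → H}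

namespace IsTradingCycle

theorem exists_executes (hc : IsTradingCycle P t μ.freeInst S c p) : ∃ ν, Executes μ ν c p := by
  classical
  have hfree : ∀ j a, μ.inst a ≠ some (p j) := fun j =>
    Matching.mem_freeInst.1 (mem_of_favorite_eq_some (hc.applicant_points j))
  refine ⟨⟨fun a => if a ∈ Set.range c then favorite (t a) μ.freeInst else μ.inst a, ?_⟩,
    fun j => (if_pos ⟨j, rfl⟩).trans (hc.applicant_points j), fun a ha => if_neg ha⟩
  intro a b h ha hb
  split_ifs at ha hb with hac hbc hbc
  · obtain ⟨i, rfl⟩ := hac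
    obtain ⟨j, rfl⟩ := hbc
    rw [hc.applicant_points, ← hb, hc.applicant_points] at ha
    rw [hc.institutions_injective (Option.some.inj ha)]
  · obtain ⟨i, rfl⟩ := hac
    rw [hc.applicant_points, ← hb] at ha
    exact absurd ha.symm (hfree i b)
  · obtain ⟨i, rfl⟩ := hbc
    rw [hc.applicant_points, ← ha] at hb
    exact absurd hb.symm (hfree i a)
  · exact μ.one_to_one a b h ha hb

theorem inst_eq_none (hc : IsTradingCycle P t μ.freeInst (activeApplicants t μ) c p)
    (j : Fin (k + 1)) : μ.inst (c j) = none :=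
  (mem_activeApplicants.1 (hc.mem j)).1

theorem mem_freeInst_of_disjoint (hc : IsTradingCycle P t μ.freeInst S c p)
    (he : Executes μ ν c p) (hc' : IsTradingCycle P t μ.freeInst S c' p')
    (hd : Disjoint (Set.range c) (Set.range c')) (j : Fin (k' + 1)) : p' j ∈ ν.freeInst := by
  rw [Matching.mem_freeInst]
  intro a ha
  by_cases hac : a ∈ Set.range c
  · obtain ⟨m, rfl⟩ := hac
    have hp : p m = p' j := Option.some.inj ((he.1 m).symm.trans ha)
    exact Set.disjoint_left.1 hd ⟨m + 1, (hp ▸ hc.institution_points m).eq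
      (hc'.institution_points j)⟩ (Set.mem_range_self (j + 1))
  · rw [he.2 a hac] at ha
    exact Matching.mem_freeInst.1 (mem_of_favorite_eq_some (hc'.applicant_points j)) a ha

theorem of_disjoint (hc : IsTradingCycle P t μ.freeInst (activeApplicants t μ) c p)
    (he : Executes μ ν c p) (hc' : IsTradingCycle P t μ.freeInst (activeApplicants t μ) c' p')
    (hd : Disjoint (Set.range c) (Set.range c')) :
    IsTradingCycle P t ν.freeInst (activeApplicants t ν) c' p' := by
  have hext : μ.Extends ν := he.extends_of_inst_eq_none hc.inst_eq_none
  have hpoint : ∀ j, favorite (t (c' j)) ν.freeInst = some (p' j) := fun j =>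
    favorite_eq_some_of_subset (hc'.applicant_points j) hext.freeInst_subset
      (hc.mem_freeInst_of_disjoint he hc' hd j)
  have hmem : ∀ j, c' j ∈ activeApplicants t ν := by
    intro j
    rw [mem_activeApplicants, hpoint, he.2 _ (Set.disjoint_right.1 hd (Set.mem_range_self j))]
    exact ⟨hc'.inst_eq_none j, by simp⟩
  exact ⟨hc'.injective, hmem, hpoint, fun j =>
    (hc'.institution_points j).mono (hext.activeApplicants_subset t) (hmem _)⟩

end IsTradingCycle

theorem TTCStep.extends (h : TTCStep P t μ ν) : μ.Extends ν := by
  obtain ⟨k, c, p, hc, he⟩ := h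
  exact he.extends_of_inst_eq_none hc.inst_eq_none

namespace TTCStep

theorem diamond (h₁ : TTCStep P t μ ν₁) (h₂ : TTCStep P t μ ν₂) :
    ν₁ = ν₂ ∨ ∃ ξ, TTCStep P t ν₁ ξ ∧ TTCStep P t ν₂ ξ := by
  obtain ⟨k, c, p, hc, he⟩ := h₁
  obtain ⟨k', c', p', hc', he'⟩ := h₂
  rcases hc.range_eq_or_disjoint hc' with hr | hd
  · exact .inl (he.eq_of_range_eq he' hc.applicant_points hc'.applicant_points hr)
  · have hc₁ := hc.of_disjoint he hc' hd
    have hc₂ := hc'.of_disjoint he' hc hd.symm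
    obtain ⟨ξ, hξ⟩ := hc₁.exists_executes
    exact .inr ⟨ξ, ⟨k', c', p', hc₁, hξ⟩, k, c, p, hc₂, he.comm_of_disjoint he' hξ hd⟩

theorem of_favorite_eq (h : TTCStep P t μ ν)
    (ht : ∀ a, μ.inst a = none → favorite (t a) μ.freeInst = favorite (t' a) μ.freeInst) :
    TTCStep P t' μ ν := by
  obtain ⟨k, c, p, hc, he⟩ := h
  have hS : activeApplicants t μ = activeApplicants t' μ := by
    ext a
    exact mem_activeApplicants_congr (ht a)
  exact ⟨k, c, p, hc.congr (fun j => ht _ (hc.inst_eq_none j)) hS.ge (hS ▸ hc.mem), he⟩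

end TTCStep

theorem extends_of_reflTransGen_ttcStep (h : Relation.ReflTransGen (TTCStep P t) μ ν) :
    μ.Extends ν :=
  Matching.extends_of_reflTransGen (fun _ _ => TTCStep.extends) h

theorem inst_eq_none_of_reflTransGen_ttcStep {a : A}
    (h : Relation.ReflTransGen (TTCStep P t) μ ν) (hμ : μ.inst a = none)
    (ha : favorite (t a) μ.freeInst = none) : ν.inst a = none := by
  induction h with
  | refl => exact hμ
  | tail hη hs ih =>
    obtain ⟨k, c, p, hc, he⟩ := hs
    rw [he.2 a, ih]
    rintro ⟨j, rfl⟩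
    exact (mem_activeApplicants.1 (hc.mem j)).2 (favorite_eq_none_of_subset ha
      (extends_of_reflTransGen_ttcStep hη).freeInst_subset)

theorem activeApplicants_eq_empty_iff :
    activeApplicants t μ = ∅ ↔ ∀ ν, ¬ TTCStep P t μ ν := by
  classical
  refine ⟨?_, fun h => ?_⟩
  · rintro h ν ⟨k, c, p, hc, -⟩
    simpa [h] using hc.mem 0
  · by_contra hne
    obtain ⟨ν, hν⟩ := exists_ttcStep P t μ (Finset.nonempty_iff_ne_empty.2 hne)
    exact h ν hν

theorem TTCRun.unique (h₁ : TTCRun P t μ ν₁) (h₂ : TTCRun P t μ ν₂) : ν₁ = ν₂ := by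
  obtain ⟨ξ, hξ₁, hξ₂⟩ := Relation.church_rosser (r := TTCStep P t) (fun a b c hab hac => by
    rcases hab.diamond hac with rfl | ⟨ξ, hb, hc⟩
    · exact ⟨b, .refl, .refl⟩
    · exact ⟨ξ, .single hb, .single hc⟩) h₁.1 h₂.1
  rw [Relation.reflTransGen_iff_eq (activeApplicants_eq_empty_iff.1 h₁.2)] at hξ₁
  rw [Relation.reflTransGen_iff_eq (activeApplicants_eq_empty_iff.1 h₂.2)] at hξ₂
  exact hξ₁.symm.trans hξ₂

end Steps

section Runs

variable {A H : Type} [Fintype A] [DecidableEq A] [Fintype H] [DecidableEq H]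
  {P : H → LinearOrder A} {t t' : A → PrefList H} {μ ν : Matching A H} {i : A}

namespace TTCRun

theorem eq_ttc (hμ : Relation.ReflTransGen (TTCStep P t) (Matching.empty A H) μ)
    (hν : TTCRun P t μ ν) : ν = ttc P t :=
  unique ⟨hμ.trans hν.1, hν.2⟩ (exists_ttcRun P t (Matching.empty A H)).choose_spec

end TTCRun

namespace TTCStepWithout

theorem ttcStep (h : TTCStepWithout P i t μ ν) : TTCStep P t μ ν := by
  obtain ⟨k, c, p, hc, hi, he⟩ := h
  exact ⟨k, c, p, hc.congr (fun _ => rfl) (Finset.subset_insert _ _)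
    fun j => Finset.mem_of_mem_insert_of_ne (hc.mem j) (hi j), he⟩

theorem inst_self (h : TTCStepWithout P i t μ ν) : ν.inst i = μ.inst i := by
  obtain ⟨k, c, p, -, hi, he⟩ := h
  exact he.2 i fun ⟨j, hj⟩ => hi j hj

theorem of_favorite_eq (h : TTCStepWithout P i t μ ν)
    (ht : ∀ a, a ≠ i → μ.inst a = none →
      favorite (t a) μ.freeInst = favorite (t' a) μ.freeInst) : TTCStepWithout P i t' μ ν := by
  obtain ⟨k, c, p, hc, hi, he⟩ := h
  have hS : insert i (activeApplicants t μ) = insert i (activeApplicants t' μ) := by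
    ext a
    simp only [Finset.mem_insert]
    exact or_congr_right' fun ha => mem_activeApplicants_congr (ht a ha)
  have hnone : ∀ j, μ.inst (c j) = none := fun j =>
    (mem_activeApplicants.1 (Finset.mem_of_mem_insert_of_ne (hc.mem j) (hi j))).1
  exact ⟨k, c, p, hc.congr (fun j => ht _ (hi j) (hnone j)) hS.ge (hS ▸ hc.mem), hi, he⟩

end TTCStepWithout

theorem TTCStep.inst_eq_favorite_of_forall_not_ttcStepWithout (hν : TTCStep P t μ ν)
    (hμ : ∀ ξ, ¬ TTCStepWithout P i t μ ξ) (hi : i ∈ activeApplicants t μ) :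
    ν.inst i = favorite (t i) μ.freeInst := by
  obtain ⟨k, c, p, hc, he⟩ := hν
  refine he.inst_of_mem_range hc.applicant_points (by_contra fun hr => hμ ν ?_)
  exact ⟨k, c, p, by rwa [Finset.insert_eq_of_mem hi], fun j hj => hr ⟨j, hj⟩, he⟩

namespace TTCRunWithout

theorem reflTransGen (h : TTCRunWithout P i t μ) :
    Relation.ReflTransGen (TTCStep P t) (Matching.empty A H) μ :=
  Relation.ReflTransGen.mono (fun _ _ => TTCStepWithout.ttcStep) _ _ h.1

theorem inst_self (h : TTCRunWithout P i t μ) : μ.inst i = none := by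
  obtain ⟨h, -⟩ := h
  induction h with
  | refl => rfl
  | tail _ hs ih => rw [hs.inst_self, ih]

theorem update (h : TTCRunWithout P i t μ) (x : PrefList H) :
    TTCRunWithout P i (Function.update t i x) μ := by
  refine ⟨Relation.ReflTransGen.mono (fun _ _ hs => hs.of_favorite_eq fun a ha _ => ?_) _ _ h.1,
    fun ν hν => h.2 ν (hν.of_favorite_eq fun a ha _ => ?_)⟩ <;>
  rw [Function.update_of_ne ha]

theorem ttc_inst_self (h : TTCRunWithout P i t μ) :
    (ttc P t).inst i = favorite (t i) μ.freeInst := by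
  cases hf : favorite (t i) μ.freeInst with
  | none =>
    obtain ⟨ν, hν⟩ := exists_ttcRun P t μ
    rw [← hν.eq_ttc h.reflTransGen]
    exact inst_eq_none_of_reflTransGen_ttcStep hν.1 h.inst_self hf
  | some b =>
    have hi : i ∈ activeApplicants t μ := mem_activeApplicants.2 ⟨h.inst_self, by simp [hf]⟩
    obtain ⟨ν, hν⟩ := exists_ttcStep P t μ ⟨i, hi⟩
    have hνi := (hν.inst_eq_favorite_of_forall_not_ttcStepWithout h.2 hi).trans hf
    obtain ⟨ξ, hξ⟩ := exists_ttcRun P t ν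
    rw [← hξ.eq_ttc (h.reflTransGen.tail hν)]
    exact extends_of_reflTransGen_ttcStep hξ.1 i b hνi

end TTCRunWithout

theorem menu_ttcOn {𝒯 : A → Set (PrefList H)} {t : (a : A) → 𝒯 a}
    (h : TTCRunWithout P i (fun a => (t a).1) μ) :
    menu (ttcOn P 𝒯) i t = {o | ∃ l ∈ 𝒯 i, favorite l μ.freeInst = o} := by
  have key : ∀ x : 𝒯 i,
      (ttcOn P 𝒯 (Function.update t i x)).inst i = favorite x.1 μ.freeInst := by
    intro x
    have hu : (fun a => (Function.update t i x a).1) =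
        Function.update (fun a => (t a).1) i x.1 := by
      funext a
      rcases eq_or_ne a i with rfl | ha
      · simp
      · simp [ha]
    rw [ttcOn, hu, (h.update x.1).ttc_inst_self, Function.update_self]
  ext o
  simp only [menu, key, Set.mem_ofPred_eq, Subtype.exists, exists_prop]

end Runs

namespace ExtensiveFormDescription

variable {ι : Type} {T : ι → Type} {D : ExtensiveFormDescription ι T}

theorem OnPath.exists_visits [DecidableEq ι] {t : (i : ι) → T i} {v : D.V} (hv : D.OnPath t v) :
    ∃ m, D.Visits t v m := by
  induction hv with
  | refl => exact ⟨_, .source⟩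
  | tail _ hs ih =>
    obtain ⟨m, hm⟩ := ih
    exact ⟨_, hm.step hs⟩

theorem memory_le_logb {n : ℕ} (hn : ∀ j, (Finset.univ.filter fun v => D.layer v = j).card ≤ n) :
    D.memory ≤ Real.logb 2 n := by
  have hsup : ((Finset.Icc 1 D.L).sup fun j =>
      (Finset.univ.filter fun v => D.layer v = j).card) ≤ n := Finset.sup_le fun j _ => hn j
  rcases Nat.eq_zero_or_pos ((Finset.Icc 1 D.L).sup fun j =>
    (Finset.univ.filter fun v => D.layer v = j).card) with h | h
  · rw [memory, h, Nat.cast_zero, Real.logb_zero]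
    exact div_nonneg (Real.log_natCast_nonneg n) (Real.log_nonneg one_le_two)
  · exact Real.logb_le_logb_of_le one_lt_two (by exact_mod_cast h) (by exact_mod_cast hsup)

end ExtensiveFormDescription

/-- A configuration of a procedure that reads preference lists entry by entry: the number of
entries of each list that have been read, and a state. -/
structure ReadConfig (A σ : Type) where
  /-- The number of entries that have been read. -/
  counter : A → ℕ
  /-- What the procedure remembers about these entries. -/
  state : σ

/-- The initial configuration with state `s₀`: no entries have been read. -/
def ReadConfig.start {A σ : Type} (s₀ : σ) : ReadConfig A σ := ⟨fun _ => 0, s₀⟩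

/-- A step of a procedure that reads preference lists entry by entry: the next entry of one list is
read. A procedure is a list of such steps. -/
structure ReadStep (A H σ : Type) where
  /-- The applicant whose next entry is read. -/
  target : ReadConfig A σ → A
  /-- The state after an entry (`none` if the list has ended) has been read. -/
  update : ReadConfig A σ → Option H → σ

namespace ReadStep

variable {A H σ : Type}

/-- The vertices of the extensive-form description of `prog`: the source `none`, and for each
step the configurations that may result from it. The counters are bounded by the length of `prog`,
which makes the layers finite. -/
abbrev Vertex (prog : List (ReadStep A H σ)) : Type :=
  Option (Fin prog.length × (A → Fin (prog.length + 1)) × σ)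

namespace Vertex

variable {prog : List (ReadStep A H σ)}

/-- The number of steps before a vertex. -/
def time : Vertex prog → ℕ
  | none => 0
  | some v => v.1 + 1

/-- The configuration at a vertex, where `s₀` is the initial state. -/
def config (s₀ : σ) : Vertex prog → ReadConfig A σ
  | none => .start s₀
  | some v => ⟨fun a => v.2.1 a, v.2.2⟩

/-- The vertex with configuration `x` that is reached by the step `j`. The counters of `x` are
reduced modulo `prog.length + 1`. -/
def ofConfig (j : Fin prog.length) (x : ReadConfig A σ) : Vertex prog :=
  some (j, fun a => Fin.ofNat (prog.length + 1) (x.counter a), x.state)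

theorem time_le : ∀ v : Vertex prog, v.time ≤ prog.length
  | none => Nat.zero_le _
  | some v => v.1.2

theorem eq_none_of_time_eq_zero : ∀ {v : Vertex prog}, v.time = 0 → v = none
  | none, _ => rfl

theorem config_ofConfig {s₀ : σ} {j : Fin prog.length} {x : ReadConfig A σ}
    (hx : ∀ a, x.counter a ≤ prog.length) : (ofConfig j x).config s₀ = x :=
  congrArg (ReadConfig.mk · x.state) (funext fun a => Nat.mod_eq_of_lt (Nat.lt_succ_of_le (hx a)))

theorem exists_time_eq_add_one {v : Vertex prog} (hv : v ≠ none) :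
    ∃ u : Vertex prog, v.time = u.time + 1 := by
  obtain ⟨⟨⟨j, hj⟩, p⟩, rfl⟩ := Option.ne_none_iff_exists'.1 hv
  cases j with
  | zero => exact ⟨none, rfl⟩
  | succ j => exact ⟨some (⟨j, by omega⟩, p), rfl⟩

variable [Fintype A] [DecidableEq A] [Fintype σ]

theorem card_filter_time_eq_add_one {j : ℕ} (hj : j < prog.length) :
    (Finset.univ.filter fun v : Vertex prog => v.time = j + 1).card =
      (prog.length + 1) ^ Fintype.card A * Fintype.card σ := by
  have hlayer : (Finset.univ.filter fun v : Vertex prog => v.time = j + 1) =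
      Finset.univ.map (((Function.Embedding.sectR (⟨j, hj⟩ : Fin prog.length)
        ((A → Fin (prog.length + 1)) × σ))).trans Function.Embedding.some) := by
    ext v
    rcases v with _ | ⟨⟨k, hk⟩, p⟩ <;> simp [time, eq_comm]
  rw [hlayer, Finset.card_map]
  simp

theorem card_filter_time_le [Nonempty σ] (j : ℕ) :
    (Finset.univ.filter fun v : Vertex prog => v.time = j).card ≤
      (prog.length + 1) ^ Fintype.card A * Fintype.card σ := by
  cases j with
  | zero =>
    refine (Finset.card_le_one_iff.2 fun hv hw => ?_).trans
      (Nat.mul_pos (by positivity) Fintype.card_pos)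
    rw [eq_none_of_time_eq_zero (Finset.mem_filter.1 hv).2,
      eq_none_of_time_eq_zero (Finset.mem_filter.1 hw).2]
  | succ j =>
    by_cases hj : j < prog.length
    · exact (card_filter_time_eq_add_one hj).le
    · rw [Finset.filter_eq_empty_iff.2 fun v _ hv => hj (hv.ge.trans v.time_le), Finset.card_empty]
      exact Nat.zero_le _

theorem two_le_card_filter_time_iff [Nonempty σ] {j : ℕ} :
    2 ≤ (Finset.univ.filter fun v : Vertex prog => v.time = j + 1).card ↔ j < prog.length := by
  refine ⟨fun h => ?_, fun hj => ?_⟩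
  · obtain ⟨v, hv⟩ := Finset.card_pos.1 (zero_lt_two.trans_le h)
    have := v.time_le
    rw [(Finset.mem_filter.1 hv).2] at this
    exact this
  · rw [card_filter_time_eq_add_one hj]
    have hA : Fintype.card A ≠ 0 := by
      have s₀ : σ := Classical.arbitrary σ
      exact (Fintype.card_pos_iff.2 ⟨prog[j].target (.start s₀)⟩).ne'
    calc 2 ≤ prog.length + 1 := by omega
      _ ≤ (prog.length + 1) ^ Fintype.card A := Nat.le_self_pow hA _
      _ ≤ _ := Nat.le_mul_of_pos_right _ Fintype.card_pos

end Vertex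

variable [DecidableEq A]

/-- The configuration after the step `r` on the preference lists `t`. -/
def run (r : ReadStep A H σ) (t : A → PrefList H) (x : ReadConfig A σ) : ReadConfig A σ where
  counter b := x.counter b + if r.target x = b then 1 else 0
  state := r.update x ((t (r.target x)).1[x.counter (r.target x)]?)

theorem run_congr {r : ReadStep A H σ} {t t' : A → PrefList H} {x : ReadConfig A σ}
    (h : (t (r.target x)).1[x.counter (r.target x)]? =
      (t' (r.target x)).1[x.counter (r.target x)]?) : r.run t x = r.run t' x := by
  rw [run, run, h]

/-- The configuration after the procedure `prog` on the preference lists `t`. -/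
def runAll (prog : List (ReadStep A H σ)) (t : A → PrefList H) (x : ReadConfig A σ) :
    ReadConfig A σ :=
  prog.foldl (fun x r => r.run t x) x

theorem runAll_append (prog prog' : List (ReadStep A H σ)) (t : A → PrefList H)
    (x : ReadConfig A σ) : runAll (prog ++ prog') t x = runAll prog' t (runAll prog t x) :=
  List.foldl_append

theorem runAll_take_succ {prog : List (ReadStep A H σ)} {j : ℕ} (hj : j < prog.length)
    (t : A → PrefList H) (x : ReadConfig A σ) :
    runAll (prog.take (j + 1)) t x = prog[j].run t (runAll (prog.take j) t x) := by
  rw [List.take_succ_eq_append_getElem hj, runAll_append]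
  rfl

theorem counter_runAll_le (prog : List (ReadStep A H σ)) (t : A → PrefList H)
    (x : ReadConfig A σ) (a : A) : (runAll prog t x).counter a ≤ x.counter a + prog.length := by
  induction prog generalizing x with
  | nil => simp [runAll]
  | cons r prog ih =>
    have hr : (r.run t x).counter a ≤ x.counter a + 1 := by
      simp only [run]
      split_ifs <;> omega
    have := ih (r.run t x)
    simp only [runAll, List.foldl_cons, List.length_cons] at this ⊢
    omega

variable [Fintype A] [Fintype σ]

/-- The extensive-form description of the procedure `prog` with initial state `s₀`. -/
def description (prog : List (ReadStep A H σ)) (s₀ : σ) (𝒯 : A → Set (PrefList H)) :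
    ExtensiveFormDescription A fun a => 𝒯 a where
  V := Vertex prog
  L := prog.length + 1
  layer v := v.time + 1
  layer_mem v := Finset.mem_Icc.2 ⟨Nat.le_add_left .., Nat.succ_le_succ v.time_le⟩
  succ v := Finset.univ.filter fun w : Vertex prog => w.time = v.time + 1
  layer_succ v w hw := congrArg Nat.succ (Finset.mem_filter.1 hw).2
  source := none
  layer_source := rfl
  source_unique v hv := (Vertex.exists_time_eq_add_one hv).imp fun _ hu =>
    Finset.mem_filter.2 ⟨Finset.mem_univ _, hu⟩
  query v := prog[v.time]?.map fun r => r.target (v.config s₀)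
  query_isSome_iff v := by
    have : Nonempty σ := ⟨s₀⟩
    rw [Vertex.two_le_card_filter_time_iff]
    simp
  next v _ x := if h : v.time < prog.length then
    .ofConfig ⟨v.time, h⟩ (prog[v.time].run (fun _ => x.1) (v.config s₀)) else v
  next_mem v a ha x := by
    have h : v.time < prog.length := by
      by_contra h
      simp [List.getElem?_eq_none (not_lt.1 h)] at ha
    rw [dif_pos h]
    exact Finset.mem_filter.2 ⟨Finset.mem_univ _, rfl⟩

variable {prog : List (ReadStep A H σ)} {s₀ : σ} {𝒯 : A → Set (PrefList H)}

theorem mem_succ_description {v w : Vertex prog} :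
    w ∈ (description prog s₀ 𝒯).succ v ↔ w.time = v.time + 1 :=
  Finset.mem_filter.trans (and_iff_right (Finset.mem_univ w))

theorem query_description_eq_some {v : Vertex prog} (h : v.time < prog.length) :
    (description prog s₀ 𝒯).query v = some (prog[v.time].target (v.config s₀)) := by
  simp [description, h]

theorem next_description {v : Vertex prog} (h : v.time < prog.length) (a : A) (x : 𝒯 a) :
    (description prog s₀ 𝒯).next v a x =
      .ofConfig ⟨v.time, h⟩ (prog[v.time].run (fun _ => x.1) (v.config s₀)) :=
  dif_pos h

theorem time_eq_length_of_succ_eq_empty {v : Vertex prog}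
    (hv : (description prog s₀ 𝒯).succ v = ∅) : v.time = prog.length := by
  have : Nonempty σ := ⟨s₀⟩
  refine v.time_le.antisymm (not_lt.1 fun h => ?_)
  have := Vertex.two_le_card_filter_time_iff.2 h
  rw [show (Finset.univ.filter fun w : Vertex prog => w.time = v.time + 1) = ∅ from hv] at this
  simp at this

theorem config_of_step_description {t : (a : A) → 𝒯 a} {v w : Vertex prog}
    (hv : v.config s₀ = runAll (prog.take v.time) (fun a => (t a).1) (.start s₀))
    (hs : (description prog s₀ 𝒯).Step t v w) :
    w.config s₀ = runAll (prog.take w.time) (fun a => (t a).1) (.start s₀) ∧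
      (w.config s₀).counter = fun a => (v.config s₀).counter a +
        if (description prog s₀ 𝒯).query v = some a then 1 else 0 := by
  obtain ⟨hw, hnext⟩ := hs
  have htime : w.time = v.time + 1 := mem_succ_description.1 hw
  have hlt : v.time < prog.length := htime.ge.trans w.time_le
  have hquery := query_description_eq_some (s₀ := s₀) (𝒯 := 𝒯) hlt
  have hrun : prog[v.time].run (fun _ => (t (prog[v.time].target (v.config s₀))).1)
      (v.config s₀) = runAll (prog.take w.time) (fun a => (t a).1) (.start s₀) := by
    rw [htime, runAll_take_succ hlt, ← hv]
    exact run_congr rfl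
  have hw : w.config s₀ = runAll (prog.take w.time) (fun a => (t a).1) (.start s₀) := by
    refine (congrArg (Vertex.config s₀) ((hnext _ hquery).trans (next_description hlt _ _))).trans
      ((Vertex.config_ofConfig fun a => ?_).trans hrun)
    calc _ ≤ 0 + (prog.take w.time).length := hrun ▸ counter_runAll_le _ _ _ _
      _ ≤ prog.length := by simp
  refine ⟨hw, ?_⟩
  rw [hw, ← hrun, hquery]
  simp only [Option.some.injEq]
  rfl

theorem config_of_visits_description {t : (a : A) → 𝒯 a}
    {v : (description prog s₀ 𝒯).V} {m : A → ℕ} (hv : (description prog s₀ 𝒯).Visits t v m) :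
    Vertex.config s₀ v = runAll (prog.take (Vertex.time v)) (fun a => (t a).1) (.start s₀) ∧
      (Vertex.config s₀ v).counter = m := by
  induction hv with
  | source => exact ⟨rfl, rfl⟩
  | step _ hs ih =>
    obtain ⟨hconfig, rfl⟩ := ih
    exact config_of_step_description hconfig hs

theorem config_of_onPath_description {t : (a : A) → 𝒯 a} {v : Vertex prog}
    (hv : (description prog s₀ 𝒯).OnPath t v) :
    v.config s₀ = runAll (prog.take v.time) (fun a => (t a).1) (.start s₀) :=
  (config_of_visits_description hv.exists_visits.choose_spec).1

theorem isApplicantProposing_description (prog : List (ReadStep A H σ)) (s₀ : σ)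
    (𝒯 : A → Set (PrefList H)) : (description prog s₀ 𝒯).IsApplicantProposing := by
  intro t v m hv i hi x y hxy
  change Vertex prog at v
  obtain ⟨-, rfl⟩ := config_of_visits_description hv
  by_cases hlt : v.time < prog.length
  · obtain rfl := Option.some.inj ((query_description_eq_some hlt).symm.trans hi)
    rw [next_description hlt, next_description hlt,
      run_congr (t := fun _ => x.1) (t' := fun _ => y.1) hxy]
  · simp [description, hlt]

theorem memory_description_le (prog : List (ReadStep A H σ)) (s₀ : σ)
    (𝒯 : A → Set (PrefList H)) : (description prog s₀ 𝒯).memory ≤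
      Real.logb 2 (((prog.length + 1) ^ Fintype.card A * Fintype.card σ : ℕ) : ℝ) := by
  have : Nonempty σ := ⟨s₀⟩
  refine ExtensiveFormDescription.memory_le_logb fun j => ?_
  calc _ = (Finset.univ.filter fun v : Vertex prog => v.time + 1 = j).card := rfl
    _ ≤ (Finset.univ.filter fun v : Vertex prog => v.time = j - 1).card :=
      Finset.card_le_card (Finset.monotone_filter_right _ fun _ _ => Nat.eq_sub_of_add_eq)
    _ ≤ _ := Vertex.card_filter_time_le _

theorem isIndividualizedDictatorship_description {pre post : List (ReadStep A H σ)}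
    {r : ReadStep A H σ} {f : ((a : A) → 𝒯 a) → Matching A H} {i : A}
    (hpre : ∀ q ∈ pre, ∀ x, q.target x ≠ i) (hr : ∀ x, r.target x = i)
    (M : σ → Set (Option H))
    (hM : ∀ t : (a : A) → 𝒯 a,
      M (runAll pre (fun a => (t a).1) (.start s₀)).state = menu f i t)
    (label : σ → Matching A H)
    (hlabel : ∀ t : (a : A) → 𝒯 a,
      label (runAll (pre ++ r :: post) (fun a => (t a).1) (.start s₀)).state = f t) :
    (description (pre ++ r :: post) s₀ 𝒯).IsIndividualizedDictatorship f i := by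
  have hlen : pre.length < (pre ++ r :: post).length := by simp
  refine ⟨⟨fun v => label (Vertex.config s₀ v).state, fun t v hv hs => ?_⟩, pre.length + 1,
    Finset.mem_Icc.2 ⟨Nat.le_add_left .., Nat.succ_le_succ hlen.le⟩, fun v hv => ?_,
    fun v hv => ?_, fun v => M (Vertex.config s₀ v).state, fun v hv t ht => ?_⟩
  · beta_reduce
    rw [config_of_onPath_description hv, time_eq_length_of_succ_eq_empty hs, List.take_length,
      hlabel]
  · have hlt : Vertex.time v < pre.length := Nat.lt_of_succ_lt_succ hv
    refine ⟨_, ?_, query_description_eq_some (hlt.trans hlen)⟩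
    rw [List.getElem_append_left hlt]
    exact hpre _ (List.getElem_mem hlt) _
  · have htime : Vertex.time v = pre.length := Nat.succ_injective hv
    rw [query_description_eq_some (htime.trans_lt hlen)]
    simp [htime, hr]
  · have htime : Vertex.time v = pre.length := Nat.succ_injective hv
    beta_reduce
    rw [config_of_onPath_description ht, htime, List.take_left, hM]

end ReadStep

namespace PrefList

variable {H : Type}

/-- The empty preference list. -/
def nil : PrefList H := ⟨[], List.nodup_nil⟩

theorem length_le [Fintype H] (l : PrefList H) : l.1.length ≤ Fintype.card H :=
  l.2.length_le_card

theorem eq_of_getElem?_eq {l l' : PrefList H} {n : ℕ} (hl : l.1.length ≤ n) (hl' : l'.1.length ≤ n)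
    (h : ∀ j < n, l.1[j]? = l'.1[j]?) : l = l' := by
  refine Subtype.ext (List.ext_getElem? fun j => ?_)
  by_cases hj : j < n
  · exact h j hj
  · rw [List.getElem?_eq_none (by omega), List.getElem?_eq_none (by omega)]

variable [DecidableEq H]

/-- The list `l` followed by the entry `o`. If this is not a preference list because the entry
occurs in `l`, then the junk value is `l`. -/
def append (l : PrefList H) (o : Option H) : PrefList H :=
  if h : (l.1 ++ o.toList).Nodup then ⟨_, h⟩ else l

theorem append_val {l : PrefList H} {o : Option H} (h : (l.1 ++ o.toList).Nodup) :
    (l.append o).1 = l.1 ++ o.toList :=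
  congrArg Subtype.val (dif_pos h)

theorem length_nil_append_le (o : Option H) : (nil.append o).1.length ≤ 1 := by
  cases o <;> simp [append, nil]

end PrefList

/-- The state of a simulation of Top Trading Cycles that reads the preference lists entry by entry:
a partial matching, and a part of the list of each applicant, which has at most one entry unless the
applicant is in `D`. -/
@[ext] structure SimState (A H : Type) (D : Finset A) where
  /-- The partial matching that has been reached. -/
  matching : Matching A H
  /-- The stored part of the list of each applicant. -/
  known : A → PrefList H
  length_known : ∀ a ∉ D, (known a).1.length ≤ 1

namespace SimState

variable {A H : Type} {D : Finset A}

/-- The initial state: nobody is matched, and no entries are stored. -/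
def start : SimState A H D where
  matching := .empty A H
  known _ := .nil
  length_known _ _ := Nat.zero_le _

section Card

variable [Fintype H]

/-- The matches and entries that a state consists of. -/
def code (s : SimState A H D) :
    (A → Option H) × (A → Option H) × (D → Fin (Fintype.card H) → Option H) :=
  (s.matching.inst, fun a => (s.known a).1[0]?, fun a j => (s.known a).1[j.1]?)

theorem code_injective : Function.Injective (code : SimState A H D → _) := by
  intro s s' h
  simp only [code, Prod.mk.injEq] at h
  obtain ⟨hinst, hfirst, hall⟩ := h
  refine SimState.ext (Matching.ext hinst) (funext fun a => ?_)
  by_cases ha : a ∈ D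
  · exact PrefList.eq_of_getElem?_eq (PrefList.length_le _) (PrefList.length_le _)
      fun j hj => congrFun (congrFun hall ⟨a, ha⟩) ⟨j, hj⟩
  · refine PrefList.eq_of_getElem?_eq (s.length_known a ha) (s'.length_known a ha) fun j hj => ?_
    obtain rfl := Nat.lt_one_iff.1 hj
    exact congrFun hfirst a

variable [Fintype A] [DecidableEq A]

noncomputable instance : Fintype (SimState A H D) :=
  Fintype.ofInjective _ code_injective

theorem card_le : Fintype.card (SimState A H D) ≤
    (Fintype.card H + 1) ^ (2 * Fintype.card A + D.card * Fintype.card H) := by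
  refine (Fintype.card_le_of_injective _ code_injective).trans_eq ?_
  simp only [Fintype.card_prod, Fintype.card_fun, Fintype.card_option, Fintype.card_fin,
    Fintype.card_coe]
  ring

end Card

section Read

variable [DecidableEq A] [DecidableEq H]

/-- The state after the next entry `o` of the list of `a` has been read. It replaces the
previous entry unless `a` is in `D`. -/
def read (s : SimState A H D) (a : A) (o : Option H) : SimState A H D where
  matching := s.matching
  known := Function.update s.known a ((if a ∈ D then s.known a else .nil).append o)
  length_known b hb := by
    rcases eq_or_ne b a with rfl | hba
    · rw [Function.update_self, if_neg hb]
      exact PrefList.length_nil_append_le o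
    · rw [Function.update_of_ne hba]
      exact s.length_known b hb

/-- The step that reads the next entry of the list of `d`. -/
def readStep (d : A) : ReadStep A H (SimState A H D) where
  target _ := d
  update x o := x.state.read d o

theorem counter_runAll_replicate_readStep (d : A) (k : ℕ) (t : A → PrefList H)
    (x : ReadConfig A (SimState A H D)) (a : A) :
    (ReadStep.runAll (List.replicate k (readStep d)) t x).counter a =
      x.counter a + if d = a then k else 0 := by
  induction k generalizing x with
  | zero => simp [ReadStep.runAll]
  | succ k ih =>
    refine (ih _).trans ?_
    change (x.counter a + if d = a then 1 else 0) + _ = _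
    split_ifs <;> omega

theorem matching_runAll_replicate_readStep (d : A) (k : ℕ) (t : A → PrefList H)
    (x : ReadConfig A (SimState A H D)) :
    (ReadStep.runAll (List.replicate k (readStep d)) t x).state.matching = x.state.matching := by
  induction k generalizing x with
  | zero => rfl
  | succ _ ih => exact ih _

end Read

section Consistent

variable [Fintype A] [Fintype H] [DecidableEq H]

/-- What the state of `x` stores about the lists `t` is correct: it is the part of each list that
has been read, except for some institutions that are matched already. -/
def Consistent (t : A → PrefList H) (x : ReadConfig A (SimState A H D)) : Prop :=
  ∀ a, ∃ pre, (t a).1.take (x.counter a) = pre ++ (x.state.known a).1 ∧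
    ∀ h ∈ pre, h ∉ x.state.matching.freeInst

/-- The next entry of the list of `a` has to be read in order to find her favorite. -/
def Pending (x : ReadConfig A (SimState A H D)) (a : A) : Prop :=
  a ∉ D ∧ x.state.matching.inst a = none ∧ x.counter a < Fintype.card H ∧
    favorite (x.state.known a) x.state.matching.freeInst = none

variable {t : A → PrefList H} {x : ReadConfig A (SimState A H D)} {a : A}

theorem consistent_start (t : A → PrefList H) :
    Consistent t (.start start : ReadConfig A (SimState A H D)) :=
  fun _ => ⟨[], rfl, by simp⟩

namespace Consistent

theorem setMatching (hx : Consistent t x) {μ : Matching A H} (hμ : x.state.matching.Extends μ) :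
    Consistent t ⟨x.counter, { x.state with matching := μ }⟩ := fun a =>
  (hx a).imp fun _ h => ⟨h.1, fun b hb hb' => h.2 b hb (hμ.freeInst_subset hb')⟩

theorem favorite_known (hx : Consistent t x) (ha : x.state.matching.inst a = none)
    (hp : ¬ Pending x a) (hD : a ∈ D → Fintype.card H ≤ x.counter a) :
    favorite (x.state.known a) x.state.matching.freeInst =
      favorite (t a) x.state.matching.freeInst := by
  obtain ⟨pre, htake, hpre⟩ := hx a
  have hnone : pre.find? (fun h => decide (h ∈ x.state.matching.freeInst)) = none := by
    simpa [List.find?_eq_none] using hpre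
  have hsplit : favorite (t a) x.state.matching.freeInst =
      (favorite (x.state.known a) x.state.matching.freeInst).or
        (((t a).1.drop (x.counter a)).find? fun h =>
          decide (h ∈ x.state.matching.freeInst)) := by
    conv_lhs => rw [favorite, ← List.take_append_drop (x.counter a) (t a).1, htake]
    rw [List.find?_append, List.find?_append, hnone, Option.none_or]
    rfl
  rw [hsplit]
  cases hf : favorite (x.state.known a) x.state.matching.freeInst with
  | some h => rfl
  | none =>
    have hread : Fintype.card H ≤ x.counter a := by
      by_contra hlt
      exact hp ⟨fun h => hlt (hD h), ha, not_le.1 hlt, hf⟩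
    rw [List.drop_eq_nil_of_le ((t a).length_le.trans hread)]
    rfl

variable [DecidableEq A]

theorem read (hx : Consistent t x)
    (ha : a ∈ D ∨ favorite (x.state.known a) x.state.matching.freeInst = none) :
    Consistent t ⟨fun b => x.counter b + if a = b then 1 else 0,
      x.state.read a (t a).1[x.counter a]?⟩ := by
  intro b
  obtain ⟨pre, htake, hpre⟩ := hx b
  rcases eq_or_ne a b with rfl | hab
  · have htake' : (t a).1.take (x.counter a + 1) =
        pre ++ ((x.state.known a).1 ++ ((t a).1[x.counter a]?).toList) := by
      rw [List.take_add_one, htake, List.append_assoc]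
    simp only [SimState.read, if_true, Function.update_self, htake']
    split_ifs with haD
    · have hnodup : ((x.state.known a).1 ++ ((t a).1[x.counter a]?).toList).Nodup :=
        (htake' ▸ (t a).2.sublist (List.take_sublist _ _)).of_append_right
      exact ⟨pre, by rw [PrefList.append_val hnodup], hpre⟩
    · refine ⟨pre ++ (x.state.known a).1, ?_, fun h hh => ?_⟩
      · rw [PrefList.append_val (by cases (t a).1[x.counter a]? <;> simp [PrefList.nil]),
          List.append_assoc]
        rfl
      · rcases List.mem_append.1 hh with hh | hh
        · exact hpre h hh
        · exact favorite_eq_none_iff.1 (ha.resolve_left haD) h hh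
  · refine ⟨pre, ?_, hpre⟩
    simp [SimState.read, hab, hab.symm, htake]

theorem runAll_replicate_readStep {d : A} (hd : d ∈ D) (hx : Consistent t x) (k : ℕ) :
    Consistent t (ReadStep.runAll (List.replicate k (readStep d)) t x) := by
  induction k generalizing x with
  | zero => exact hx
  | succ _ ih => exact ih (hx.read (.inl hd))

end Consistent

end Consistent

end SimState

/-- The relation `G` consists of steps that match some applicants in `X`, and that depend only on
the favorites of the unmatched applicants in `X`. -/
structure IsMatchingStep {A H : Type} [Fintype A] [Fintype H] [DecidableEq H]
    (G : (A → PrefList H) → Matching A H → Matching A H → Prop) (X : Finset A) : Prop where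
  of_favorite_eq : ∀ {t t' : A → PrefList H} {μ ν : Matching A H}, G t μ ν →
    (∀ a ∈ X, μ.inst a = none → favorite (t a) μ.freeInst = favorite (t' a) μ.freeInst) → G t' μ ν
  extension : ∀ {t : A → PrefList H} {μ ν : Matching A H}, G t μ ν → μ.Extends ν
  progress : ∀ {t : A → PrefList H} {μ ν : Matching A H}, G t μ ν →
    ∃ a ∈ X, μ.inst a = none ∧ ν.inst a ≠ none

section IsMatchingStep

variable {A H : Type} [Fintype A] [Fintype H] [DecidableEq H]

theorem isMatchingStep_ttcStep (P : H → LinearOrder A) :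
    IsMatchingStep (TTCStep P) Finset.univ where
  of_favorite_eq h ht := h.of_favorite_eq fun a ha => ht a (Finset.mem_univ _) ha
  extension h := h.extends
  progress := by
    rintro t μ ν ⟨k, c, p, hc, he⟩
    exact ⟨c 0, Finset.mem_univ _, hc.inst_eq_none 0, by simp [he.1]⟩

theorem isMatchingStep_ttcStepWithout [DecidableEq A] (P : H → LinearOrder A) (i : A) :
    IsMatchingStep (TTCStepWithout P i) (Finset.univ.erase i) where
  of_favorite_eq h ht := h.of_favorite_eq fun a hi ha => ht a (by simp [hi]) ha
  extension h := h.ttcStep.extends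
  progress := by
    rintro t μ ν ⟨k, c, p, hc, hi, he⟩
    exact ⟨c 0, by simp [hi 0],
      (mem_activeApplicants.1 (Finset.mem_of_mem_insert_of_ne (hc.mem 0) (hi 0))).1, by simp [he.1]⟩

end IsMatchingStep

namespace SimState

section Potential

variable {A H : Type} {D : Finset A} [Fintype H] {X : Finset A}
  {x y : ReadConfig A (SimState A H D)}

/-- An upper bound on the number of steps until a simulation is terminal: the number of unread
entries and unmatched applicants in `X`. -/
def potential (X : Finset A) (x : ReadConfig A (SimState A H D)) : ℕ :=
  ∑ a ∈ X, (Fintype.card H - x.counter a + if x.state.matching.inst a = none then 1 else 0)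

theorem potential_le (X : Finset A) (x : ReadConfig A (SimState A H D)) :
    potential X x ≤ X.card * (Fintype.card H + 1) := by
  refine Finset.sum_le_card_nsmul _ _ _ fun a _ => ?_
  split_ifs <;> omega

theorem potential_lt (hxy : ∀ a, x.counter a ≤ y.counter a)
    (hμ : x.state.matching.Extends y.state.matching)
    (h : ∃ a ∈ X, (x.counter a < Fintype.card H ∧ x.counter a < y.counter a) ∨
      (x.state.matching.inst a = none ∧ y.state.matching.inst a ≠ none)) :
    potential X y < potential X x := by
  have hle : ∀ a, (if y.state.matching.inst a = none then 1 else 0) ≤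
      (if x.state.matching.inst a = none then 1 else 0) := by
    intro a
    by_cases ha : y.state.matching.inst a = none
    · simp [ha, hμ.inst_eq_none ha]
    · simp [ha]
  refine Finset.sum_lt_sum (fun a _ => ?_) ?_
  · exact Nat.add_le_add (Nat.sub_le_sub_left (hxy a) _) (hle a)
  · obtain ⟨a, ha, ⟨hcard, hlt⟩ | ⟨hx, hy⟩⟩ := h
    · exact ⟨a, ha, Nat.add_lt_add_of_lt_of_le (Nat.sub_lt_sub_left hcard hlt) (hle a)⟩
    · exact ⟨a, ha, by simpa [hx, hy] using Nat.lt_succ_of_le (Nat.sub_le_sub_left (hxy a) _)⟩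

end Potential

variable {A H : Type} {D : Finset A} [Fintype A] [Fintype H] [DecidableEq H]
  {G : (A → PrefList H) → Matching A H → Matching A H → Prop} {X : Finset A} {e : A}
  {t : A → PrefList H} {μ₀ ν : Matching A H} {x : ReadConfig A (SimState A H D)} {b : ℕ}

open Classical in
/-- The applicant whose list is read in a simulation: one whose next entry is needed if there is
one, and `e` otherwise. -/
noncomputable def queried (e : A) (x : ReadConfig A (SimState A H D)) : A :=
  if h : ∃ a, Pending x a then h.choose else e

open Classical in
/-- The next matching in a simulation of the steps `G`. It stays the same as long as more entries
are needed. -/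
noncomputable def nextMatching (G : (A → PrefList H) → Matching A H → Matching A H → Prop)
    (x : ReadConfig A (SimState A H D)) : Matching A H :=
  if h : (∀ a, ¬ Pending x a) ∧ ∃ ν, G x.state.known x.state.matching ν then h.2.choose
  else x.state.matching

theorem pending_queried (h : ∃ a, Pending x a) : Pending x (queried e x) := by
  rw [queried, dif_pos h]
  exact h.choose_spec

theorem queried_eq (h : ∀ a, ¬ Pending x a) : queried e x = e :=
  dif_neg (not_exists.2 h)

theorem queried_ne {i : A} (hi : i ∈ D) (he : e ≠ i) : queried e x ≠ i := by
  by_cases h : ∃ a, Pending x a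
  · rintro rfl
    exact (pending_queried h).1 hi
  · rwa [queried_eq (not_exists.1 h)]

theorem nextMatching_eq (h : (∃ a, Pending x a) ∨ ∀ ν, ¬ G x.state.known x.state.matching ν) :
    nextMatching G x = x.state.matching := by
  refine dif_neg fun ⟨hp, ν, hν⟩ => ?_
  exact h.elim (fun ⟨a, ha⟩ => hp a ha) fun hG => hG ν hν

theorem nextMatching_spec (hp : ∀ a, ¬ Pending x a)
    (h : ∃ ν, G x.state.known x.state.matching ν) :
    G x.state.known x.state.matching (nextMatching G x) := by
  rw [nextMatching, dif_pos ⟨hp, h⟩]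
  exact h.choose_spec

theorem extends_nextMatching (hG : IsMatchingStep G X) :
    x.state.matching.Extends (nextMatching G x) := by
  by_cases h : (∀ a, ¬ Pending x a) ∧ ∃ ν, G x.state.known x.state.matching ν
  · exact hG.extension (nextMatching_spec h.1 h.2)
  · rw [nextMatching, dif_neg h]
    exact fun _ _ => id

/-- A configuration in which no entry is needed and no step `G` is possible. -/
def Terminal (G : (A → PrefList H) → Matching A H → Matching A H → Prop) (t : A → PrefList H)
    (x : ReadConfig A (SimState A H D)) : Prop :=
  (∀ a, ¬ Pending x a) ∧ ∀ ν, ¬ G t x.state.matching ν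

/-- In a simulation of the steps `G` on the lists `t`, started from `μ₀`, the configuration `x` has
been reached, and it is terminal after at most `b` further steps. -/
structure Simulates (G : (A → PrefList H) → Matching A H → Matching A H → Prop) (X : Finset A)
    (t : A → PrefList H) (μ₀ : Matching A H) (b : ℕ) (x : ReadConfig A (SimState A H D)) :
    Prop where
  consistent : Consistent t x
  counter_full : ∀ a ∈ X, a ∈ D → Fintype.card H ≤ x.counter a
  reachable : Relation.ReflTransGen (G t) μ₀ x.state.matching
  progress : Terminal G t x ∨ potential X x ≤ b

namespace Simulates

theorem step_known_iff (hG : IsMatchingStep G X) (h : Simulates G X t μ₀ b x)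
    (hp : ∀ a, ¬ Pending x a) :
    G x.state.known x.state.matching ν ↔ G t x.state.matching ν := by
  have hfav : ∀ a ∈ X, x.state.matching.inst a = none →
      favorite (x.state.known a) x.state.matching.freeInst =
        favorite (t a) x.state.matching.freeInst := fun a ha hμ =>
    h.consistent.favorite_known hμ (hp a) (h.counter_full a ha)
  exact ⟨fun hν => hG.of_favorite_eq hν hfav,
    fun hν => hG.of_favorite_eq hν fun a ha hμ => (hfav a ha hμ).symm⟩

theorem reflTransGen_nextMatching (hG : IsMatchingStep G X) (h : Simulates G X t μ₀ b x) :
    Relation.ReflTransGen (G t) x.state.matching (nextMatching G x) := by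
  by_cases hs : (∀ a, ¬ Pending x a) ∧ ∃ ν, G x.state.known x.state.matching ν
  · exact .single ((h.step_known_iff hG hs.1).1 (nextMatching_spec hs.1 hs.2))
  · rw [nextMatching, dif_neg hs]

theorem forall_not_step (hG : IsMatchingStep G X) (h : Simulates G X t μ₀ 0 x) :
    ∀ ν, ¬ G t x.state.matching ν := by
  rcases h.progress with hx | hzero
  · exact hx.2
  · intro ν hν
    obtain ⟨a, ha, hnone, -⟩ := hG.progress hν
    have := Finset.sum_eq_zero_iff.1 (Nat.le_zero.1 hzero) a ha
    simp [hnone] at this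

end Simulates

variable [DecidableEq A]

/-- A step of the simulation of `G`: an entry is read, and, unless it was needed, a step of `G` is
made. -/
noncomputable def simulationStep (G : (A → PrefList H) → Matching A H → Matching A H → Prop)
    (e : A) : ReadStep A H (SimState A H D) where
  target := queried e
  update x o := { x.state.read (queried e x) o with matching := nextMatching G x }

theorem Consistent.run_simulationStep (hG : IsMatchingStep G X) (he : e ∈ D)
    (hx : Consistent t x) : Consistent t ((simulationStep G e).run t x) := by
  have hread : queried e x ∈ D ∨
      favorite (x.state.known (queried e x)) x.state.matching.freeInst = none := by
    by_cases h : ∃ a, Pending x a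
    · exact .inr (pending_queried h).2.2.2
    · exact .inl (queried_eq (not_exists.1 h) ▸ he)
  exact (hx.read hread).setMatching (extends_nextMatching (x := x) hG)

theorem Terminal.run_simulationStep (he : e ∈ D) (hx : Terminal G t x)
    (hstep : ∀ ν, ¬ G x.state.known x.state.matching ν) :
    Terminal G t ((simulationStep G e).run t x) := by
  have hmatching : ((simulationStep G e).run t x).state.matching = x.state.matching :=
    nextMatching_eq (.inr hstep)
  refine ⟨fun a ⟨haD, hnone, hcounter, hfav⟩ => hx.1 a ⟨haD, ?_⟩, fun ν => ?_⟩
  · have hae : a ≠ queried e x := by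
      rw [queried_eq hx.1]
      exact fun h => haD (h ▸ he)
    have hknown : ((simulationStep G e).run t x).state.known a = x.state.known a :=
      Function.update_of_ne hae _ _
    rw [hmatching] at hnone hfav
    rw [hknown] at hfav
    exact ⟨hnone, (Nat.le_add_right _ _).trans_lt hcounter, hfav⟩
  · rw [hmatching]
    exact hx.2 ν

namespace Simulates

theorem potential_run_lt (hG : IsMatchingStep G X) (hX : ∀ a, a ∉ D → a ∈ X)
    (h : Simulates G X t μ₀ b x) (hx : ¬ Terminal G t x) :
    potential X ((simulationStep G e).run t x) < potential X x := by
  refine potential_lt (fun a => Nat.le_add_right _ _) (extends_nextMatching hG) ?_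
  by_cases hp : ∃ a, Pending x a
  · obtain ⟨hD, -, hcounter, -⟩ := pending_queried (e := e) hp
    exact ⟨_, hX _ hD, .inl ⟨hcounter, by simp [ReadStep.run, simulationStep]⟩⟩
  · have hp := not_exists.1 hp
    obtain ⟨ν, hν⟩ : ∃ ν, G t x.state.matching ν := by
      by_contra hno
      exact hx ⟨hp, not_exists.1 hno⟩
    obtain ⟨a, ha, hμ⟩ := hG.progress (nextMatching_spec hp ⟨ν, (h.step_known_iff hG hp).2 hν⟩)
    exact ⟨a, ha, .inr hμ⟩

theorem run_simulationStep (hG : IsMatchingStep G X) (hX : ∀ a, a ∉ D → a ∈ X) (he : e ∈ D)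
    (h : Simulates G X t μ₀ (b + 1) x) :
    Simulates G X t μ₀ b ((simulationStep G e).run t x) where
  consistent := h.consistent.run_simulationStep hG he
  counter_full a ha haD := (h.counter_full a ha haD).trans (Nat.le_add_right _ _)
  reachable := h.reachable.trans (h.reflTransGen_nextMatching hG)
  progress := by
    by_cases hx : Terminal G t x
    · exact .inl (hx.run_simulationStep he fun ν hν => hx.2 ν ((h.step_known_iff hG hx.1).1 hν))
    · exact .inr (Nat.le_of_lt_succ
        ((h.potential_run_lt hG hX hx).trans_le (h.progress.resolve_left hx)))

theorem runAll_replicate (hG : IsMatchingStep G X) (hX : ∀ a, a ∉ D → a ∈ X) (he : e ∈ D)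
    (h : Simulates G X t μ₀ b x) :
    Simulates G X t μ₀ 0 (ReadStep.runAll (List.replicate b (simulationStep G e)) t x) := by
  induction b generalizing x with
  | zero => exact h
  | succ b ih => exact ih (h.run_simulationStep hG hX he)

end Simulates

end SimState

section TTCProgram

open SimState

variable {A H : Type} [Fintype A] [DecidableEq A] [Fintype H] [DecidableEq H]

/-- The steps before the dictator `i` is queried: the list of `d` is read, and then the cycles that
do not involve `i` are executed. Entries of the list of `d` are read on when no other entry is
needed. -/
noncomputable def menuPhase (P : H → LinearOrder A) (d i : A) :
    List (ReadStep A H (SimState A H {d, i})) :=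
  -- The first factor makes the phase empty if `i` is the only applicant, whence `d = i`.
  List.replicate ((Finset.univ.erase i).card * Fintype.card H) (readStep d) ++
    List.replicate ((Finset.univ.erase i).card * (Fintype.card H + 1))
      (simulationStep (TTCStepWithout P i) d)

/-- The steps from the first query to the dictator `i` on: her list is read, and then the remaining
cycles are executed. Entries of her list are read on when no other entry is needed. -/
noncomputable def outcomePhase (P : H → LinearOrder A) (d i : A) :
    List (ReadStep A H (SimState A H {d, i})) :=
  List.replicate (Fintype.card H + 1) (readStep i) ++
    List.replicate (Fintype.card A * (Fintype.card H + 1)) (simulationStep (TTCStep P) i)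

theorem outcomePhase_eq_cons (P : H → LinearOrder A) (d i : A) :
    outcomePhase P d i = readStep i :: (List.replicate (Fintype.card H) (readStep i) ++
      List.replicate (Fintype.card A * (Fintype.card H + 1)) (simulationStep (TTCStep P) i)) :=
  rfl

variable {P : H → LinearOrder A} {d i : A} {t : A → PrefList H}

theorem target_ne_of_mem_menuPhase (hd : (∃ a, a ≠ i) → d ≠ i) :
    ∀ r ∈ menuPhase P d i, ∀ x, r.target x ≠ i := by
  have hne : (Finset.univ.erase i).card ≠ 0 → d ≠ i := fun h => by
    obtain ⟨a, ha⟩ := Finset.card_ne_zero.1 h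
    exact hd ⟨a, Finset.ne_of_mem_erase ha⟩
  intro r hr x
  rcases List.mem_append.1 hr with hr | hr <;>
    obtain ⟨hcard, rfl⟩ := List.mem_replicate.1 hr <;>
    have hdi := hne (left_ne_zero_of_mul hcard)
  · exact hdi
  · exact queried_ne (by simp) hdi

theorem simulates_menuPhase (P : H → LinearOrder A) (d i : A) (t : A → PrefList H) :
    Simulates (TTCStepWithout P i) (Finset.univ.erase i) t (.empty A H) 0
      (ReadStep.runAll (menuPhase P d i) t (.start start)) := by
  rw [menuPhase, ReadStep.runAll_append]
  refine Simulates.runAll_replicate (isMatchingStep_ttcStepWithout P i)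
    (fun a ha => by simpa using fun hai => ha (by simp [hai])) (by simp)
    ⟨(consistent_start t).runAll_replicate_readStep (by simp) _, fun a hai hD => ?_, ?_,
      .inr (potential_le _ _)⟩
  · obtain rfl : a = d := by simpa [Finset.ne_of_mem_erase hai] using hD
    rw [counter_runAll_replicate_readStep, if_pos rfl]
    exact (Nat.le_mul_of_pos_left _ (Finset.card_pos.2 ⟨a, hai⟩)).trans (Nat.le_add_left _ _)
  · rw [matching_runAll_replicate_readStep]
    exact .refl

theorem ttcRunWithout_menuPhase (P : H → LinearOrder A) (d i : A) (t : A → PrefList H) :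
    TTCRunWithout P i t (ReadStep.runAll (menuPhase P d i) t (.start start)).state.matching :=
  ⟨(simulates_menuPhase P d i t).reachable,
    (simulates_menuPhase P d i t).forall_not_step (isMatchingStep_ttcStepWithout P i)⟩

theorem ttcRun_outcomePhase {μ₀ : Matching A H} {x : ReadConfig A (SimState A H {d, i})}
    (hx : Simulates (TTCStepWithout P i) (Finset.univ.erase i) t μ₀ 0 x) :
    TTCRun P t x.state.matching
      (ReadStep.runAll (outcomePhase P d i) t x).state.matching := by
  have hsim : Simulates (TTCStep P) Finset.univ t x.state.matching 0
      (ReadStep.runAll (outcomePhase P d i) t x) := by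
    rw [outcomePhase, ReadStep.runAll_append]
    refine Simulates.runAll_replicate (isMatchingStep_ttcStep P) (fun a _ => Finset.mem_univ a)
      (by simp) ⟨hx.consistent.runAll_replicate_readStep (by simp) _, fun a _ hD => ?_, ?_,
        .inr (potential_le _ _)⟩
    · rw [counter_runAll_replicate_readStep]
      rcases eq_or_ne i a with rfl | hai
      · rw [if_pos rfl]
        omega
      · exact (hx.counter_full a (by simp [hai.symm]) hD).trans (Nat.le_add_right _ _)
    · rw [matching_runAll_replicate_readStep]
  exact ⟨hsim.reachable,
    activeApplicants_eq_empty_iff.2 (hsim.forall_not_step (isMatchingStep_ttcStep P))⟩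

theorem isIndividualizedDictatorship_ttcOn (𝒯 : A → Set (PrefList H)) (P : H → LinearOrder A)
    (hd : (∃ a, a ≠ i) → d ≠ i) :
    (ReadStep.description (menuPhase P d i ++ outcomePhase P d i) start
      𝒯).IsIndividualizedDictatorship (ttcOn P 𝒯) i := by
  rw [outcomePhase_eq_cons]
  refine ReadStep.isIndividualizedDictatorship_description (target_ne_of_mem_menuPhase hd)
    (fun _ => rfl) (fun s => {o | ∃ l ∈ 𝒯 i, favorite l s.matching.freeInst = o})
    (fun t => (menu_ttcOn (ttcRunWithout_menuPhase P d i _)).symm) (fun s => s.matching) fun t => ?_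
  rw [← outcomePhase_eq_cons, ReadStep.runAll_append]
  exact (ttcRun_outcomePhase (simulates_menuPhase P d i _)).eq_ttc
    (ttcRunWithout_menuPhase P d i _).reflTransGen

theorem length_menuPhase_append_outcomePhase_le {N : ℕ} (hA : Fintype.card A ≤ N)
    (hH : Fintype.card H ≤ N) (P : H → LinearOrder A) (d i : A) :
    (menuPhase P d i ++ outcomePhase P d i).length + 1 ≤ (N + 1) ^ 3 := by
  have hcard : (Finset.univ.erase i).card + 1 = Fintype.card A :=
    Finset.card_erase_add_one (Finset.mem_univ i)
  have hN : 1 ≤ N := by omega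
  simp only [menuPhase, outcomePhase, List.length_append, List.length_replicate]
  generalize (Finset.univ.erase i).card = c at hcard
  calc c * Fintype.card H + c * (Fintype.card H + 1) +
        (Fintype.card H + 1 + Fintype.card A * (Fintype.card H + 1)) + 1
      ≤ N * N + N * (N + 1) + (N + 1 + N * (N + 1)) + 1 := by gcongr <;> omega
    _ ≤ (N + 1) ^ 3 := by nlinarith [Nat.one_le_pow 3 N hN]

theorem memory_menuPhase_append_outcomePhase_le {N : ℕ} (hA : Fintype.card A ≤ N)
    (hH : Fintype.card H ≤ N) (𝒯 : A → Set (PrefList H)) (P : H → LinearOrder A) (d i : A) :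
    (ReadStep.description (menuPhase P d i ++ outcomePhase P d i) start 𝒯).memory ≤
      7 * N * Real.logb 2 (N + 1) := by
  have hstates : Fintype.card (SimState A H {d, i}) ≤ (N + 1) ^ (4 * N) :=
    calc _ ≤ (Fintype.card H + 1) ^ (2 * Fintype.card A + _ * Fintype.card H) := card_le
      _ ≤ (N + 1) ^ (2 * N + 2 * N) := by gcongr; exacts [Nat.le_add_left _ _, Finset.card_le_two]
      _ = (N + 1) ^ (4 * N) := by ring
  have hlayer : ((menuPhase P d i ++ outcomePhase P d i).length + 1) ^ Fintype.card A *
      Fintype.card (SimState A H {d, i}) ≤ (N + 1) ^ (7 * N) :=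
    calc _ ≤ ((N + 1) ^ 3) ^ N * (N + 1) ^ (4 * N) := by
          gcongr
          · exact Nat.one_le_pow _ _ N.succ_pos
          · exact length_menuPhase_append_outcomePhase_le hA hH P d i
      _ = (N + 1) ^ (7 * N) := by rw [← pow_mul, ← pow_add]; congr 1; ring
  have : Nonempty (SimState A H {d, i}) := ⟨start⟩
  calc _ ≤ Real.logb 2 _ := ReadStep.memory_description_le _ _ _
    _ ≤ Real.logb 2 ((N + 1 : ℝ) ^ (7 * N)) := Real.logb_le_logb_of_le one_lt_two
        (Nat.cast_pos.2 (Nat.mul_pos (by positivity) Fintype.card_pos)) (by exact_mod_cast hlayer)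
    _ = 7 * N * Real.logb 2 (N + 1) := by rw [Real.logb_pow]; push_cast; ring

theorem exists_isIndividualizedDictatorship_ttcOn {N : ℕ} (hA : Fintype.card A ≤ N)
    (hH : Fintype.card H ≤ N) (𝒯 : A → Set (PrefList H)) (P : H → LinearOrder A) (i : A) :
    ∃ D : ExtensiveFormDescription A fun a => 𝒯 a,
      D.IsIndividualizedDictatorship (ttcOn P 𝒯) i ∧ D.IsApplicantProposing ∧
        D.memory ≤ 7 * N * Real.logb 2 (N + 1) := by
  obtain ⟨d, hd⟩ : ∃ d, (∃ a, a ≠ i) → d ≠ i := by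
    by_cases h : ∃ a, a ≠ i
    · exact h.imp fun _ ha _ => ha
    · exact ⟨i, fun h' => absurd h' h⟩
  exact ⟨_, isIndividualizedDictatorship_ttcOn 𝒯 P hd,
    ReadStep.isApplicantProposing_description _ _ _,
    memory_menuPhase_append_outcomePhase_le hA hH 𝒯 P d i⟩

end TTCProgram

theorem isSoftO_mul_logb (c : ℝ) :
    IsSoftO (fun n => c * n * Real.logb 2 (n + 1)) fun n => (n : ℝ) := by
  refine ⟨1, Asymptotics.IsBigO.of_bound (2 * |c| / Real.log 2) ?_⟩
  filter_upwards [Filter.eventually_ge_atTop 2] with n hn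
  have hn' : (2 : ℝ) ≤ n := by exact_mod_cast hn
  have hlog : Real.log (n + 1) ≤ 2 * Real.log n := by
    rw [← Real.log_rpow (by linarith)]
    refine Real.log_le_log (by linarith) ?_
    rw [Real.rpow_two]
    nlinarith
  have h₀ : 0 ≤ Real.log (n + 1) := Real.log_nonneg (by linarith)
  have h₁ : 0 ≤ Real.log n := Real.log_nonneg (by linarith)
  have h₂ : 0 < Real.log 2 := Real.log_pos one_lt_two
  rw [pow_one, norm_mul, norm_mul, Real.norm_eq_abs c, Real.norm_natCast, Real.logb,
    Real.norm_of_nonneg (div_nonneg h₀ h₂.le),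
    Real.norm_of_nonneg (mul_nonneg n.cast_nonneg h₁)]
  calc |c| * n * (Real.log (n + 1) / Real.log 2)
      = |c| * n / Real.log 2 * Real.log (n + 1) := by ring
    _ ≤ |c| * n / Real.log 2 * (2 * Real.log n) := by gcongr
    _ = 2 * |c| / Real.log 2 * (n * Real.log n) := by ring

theorem theorem2_general :
    (∃ B : ℕ → ℝ, IsSoftO B (fun n => (n : ℝ)) ∧
      ∀ (A H : Type) [Fintype A] [DecidableEq A] [Fintype H] [DecidableEq H]
        (𝒯 : A → Set (PrefList H)) (P : H → LinearOrder A) (i : A),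
        ∃ D : ExtensiveFormDescription A fun a => 𝒯 a,
          D.IsIndividualizedDictatorship (ttcOn P 𝒯) i ∧ D.IsApplicantProposing ∧
            D.memory ≤ B (max (Fintype.card A) (Fintype.card H))) ∧
    (∀ (A H : Type) [Fintype A] [DecidableEq A] [Fintype H] [DecidableEq H]
      (𝒯 : A → Set (PrefList H)) (P : H → LinearOrder A) (i : A) (t : (a : A) → 𝒯 a)
      (μ : Matching A H), TTCRunWithout P i (fun a => (t a).1) μ →
        menu (ttcOn P 𝒯) i t = {o | ∃ l ∈ 𝒯 i, favorite l μ.freeInst = o} ∧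
        (𝒯 i = Set.univ →
          menu (ttcOn P 𝒯) i t = insert none (some '' (μ.freeInst : Set H))) ∧
        (Fintype.card A ≤ Fintype.card H → 𝒯 i = {l | ∀ h, h ∈ l.1} →
          menu (ttcOn P 𝒯) i t = some '' (μ.freeInst : Set H)) ∧
        ∀ ν, TTCRun P (fun a => (t a).1) μ ν → ν = ttcOn P 𝒯 t) := by
  refine ⟨⟨_, isSoftO_mul_logb 7, fun A H _ _ _ _ 𝒯 P i =>
    exists_isIndividualizedDictatorship_ttcOn (le_max_left _ _) (le_max_right _ _) 𝒯 P i⟩,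
    fun A H _ _ _ _ 𝒯 P i t μ hμ => ⟨menu_ttcOn hμ, fun h => ?_, fun hAH h => ?_, fun ν hν => ?_⟩⟩
  · rw [menu_ttcOn hμ, h, setOf_favorite_univ]
  · rw [menu_ttcOn hμ, h, setOf_favorite_complete (Matching.freeInst_nonempty hAH hμ.inst_self)]
  · exact hν.eq_ttc hμ.reflTransGen

theorem theorem2 :
    -- the applicant-linear individualized dictatorship descriptions
    (∃ B : ℕ → ℝ, IsSoftO B (fun n => (n : ℝ)) ∧
      ∀ (n : ℕ) (𝒯 : Fin n → Set (PrefList (Fin n))) (P : Fin n → LinearOrder (Fin n))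
        (i : Fin n),
        ∃ D : ExtensiveFormDescription (Fin n) fun a => 𝒯 a,
          D.IsIndividualizedDictatorship (ttcOn P 𝒯) i ∧ D.IsApplicantProposing ∧
            D.memory ≤ B n) ∧
    -- the menu, and the completion of the matching
    (∀ (n : ℕ) (𝒯 : Fin n → Set (PrefList (Fin n))) (P : Fin n → LinearOrder (Fin n))
      (i : Fin n) (t : (a : Fin n) → 𝒯 a) (μ : Matching (Fin n) (Fin n)),
      TTCRunWithout P i (fun a => (t a).1) μ →
        menu (ttcOn P 𝒯) i t = {o | ∃ l ∈ 𝒯 i, favorite l μ.freeInst = o} ∧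
        (𝒯 i = Set.univ →
          menu (ttcOn P 𝒯) i t = insert none (some '' (μ.freeInst : Set (Fin n)))) ∧
        (𝒯 i = {l | ∀ h, h ∈ l.1} →
          menu (ttcOn P 𝒯) i t = some '' (μ.freeInst : Set (Fin n))) ∧
        ∀ ν, TTCRun P (fun a => (t a).1) μ ν → ν = ttcOn P 𝒯 t) := by
  obtain ⟨⟨B, hB, hD⟩, hmenu⟩ := theorem2_general
  refine ⟨⟨B, hB, fun n 𝒯 P i => by simpa using hD (Fin n) (Fin n) 𝒯 P i⟩,
    fun n 𝒯 P i t μ hμ => ?_⟩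
  simpa using hmenu (Fin n) (Fin n) 𝒯 P i t μ hμ
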